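/- Let $p\ge 0$, let $\Sigma\in\mathbb R^{p\times p}$ be a (known) symmetric positive definite matrix, and let $l_j,u_j\in[-\infty,\infty]$ with $l_j<u_j$ for $j=1,\dots,p$. For $y\in\mathbb R^p$ let the selected model be $$S(y)=\{j\in\{1,\dots,p\}:\ y_j\le l_j\ \text{or}\ y_j\ge u_j\}.$$ For $\mu\in\mathbb R^p$ let $P_\mu$ denote the law $N(\mu,\Sigma)$ of $y$, and for a model $M$ let $P_\mu(\cdot\mid M)$ and $E_\mu(\cdot\mid M)$ denote conditional probability and expectation given the event $\{S(y)=M\}$ (so $P_\mu(\cdot\mid M)$ is a truncated multivariate normal law). Let $\Phi(x;m,v)$ be the distribution function at $x$ of the normal law with mean $m$ and variance $v$, with $\Phi(-\infty;m,v)=0$ and $\Phi(x;+\infty,v)=0$ for $x<\infty$. Put $\sigma^2_{j,-j}=\Sigma_{j,j}-\Sigma_{j,-j}\Sigma_{-j,-j}^{-1}\Sigma_{-j,j}$, the variance of $y_j$ given the other coordinates. (a) Let $M$ be a model that can be selected, i.e. $M=S(y)$ for some $y\in\mathbb R^p$. Then for every $\mu\in\mathbb R^p$ we have $P_\mu(S(y)=M)>0$,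 and for every $j\in M$ the coordinate $y_j$ is square integrable under $P_\mu(\cdot\mid M)$ and $$E_\mu\Big(\big(y_j-E_\mu(y_j\mid M)\big)^2\,\Big|\,M\Big)\ \le\ \frac{\operatorname{tr}(\Sigma)}{P_\mu\big(\bigcap_{k\notin M}\{l_k<y_k<u_k\}\big)\,\prod_{k\in M}\Phi(l_k;u_k,\sigma^2_{k,-k})},$$ where the right-hand side is $+\infty$ if the denominator is $0$ (which happens exactly when some $k\in M$ has an infinite threshold). (b) Let $y\in\mathbb R^p$ be an observation and $M=S(y)$. Assume that no $j\in M$ with $l_j=-\infty$ has $y_j=u_j$, and no $j\in M$ with $u_j=+\infty$ has $y_j=l_j$; for every $\mu$ this holds for $N(\mu,\Sigma)$-almost every $y$. Then the function $\psi:\mathbb R^p\to\mathbb R^p$, $$\psi(\mu)_j=\begin{cases}\big(\Sigma^{-1}(y-E_\mu(y\mid M))\big)_j & j\in M,\\ y_j-\mu_j & j\notin M,\end{cases}$$ (where $y$ outside the conditional expectation is the fixed observation) has exactly one root $\hat\mu$. Let $\gamma_i\ge 0$ ($i\ge 1$) satisfy $\sum_i\gamma_i=\infty$ and $\sum_i\gamma_i^2<\infty$,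 let $\mu^0\in\mathbb R^p$ be any deterministic starting point (for instance $\mu^0=y$), and for $i\ge1$ let $$\mu^i_j=\begin{cases}\mu^{i-1}_j+\gamma_i\big(\Sigma^{-1}(y-y^i)\big)_j & j\in M,\\ y_j & j\notin M,\end{cases}$$ where the draw $y^i$ has, conditionally on the past up to step $i-1$, the truncated normal law $P_{\mu^{i-1}}(\cdot\mid M)$. Then $\mu^i\to\hat\mu$ almost surely. -/

import Mathlib

open MeasureTheory ProbabilityTheory Filter Topology Matrix

namespace SelectedMeans

noncomputable section

/-- The selected model `{j : y_j ≤ l_j or u_j ≤ y_j}`. -/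
def selected {p : ℕ} (l u : Fin p → EReal) (y : EuclideanSpace ℝ (Fin p)) : Finset (Fin p) :=
  open scoped Classical in
  Finset.univ.filter fun j => (y j : EReal) ≤ l j ∨ u j ≤ (y j : EReal)

/-- The event that the selected model is `M`. -/
def selectionEvent {p : ℕ} (l u : Fin p → EReal) (M : Finset (Fin p)) :
    Set (EuclideanSpace ℝ (Fin p)) :=
  {z | selected l u z = M}

/-- The conditional law of `z ∼ N(μ, S)` given that the model `M` is selected, i.e. the
truncated multivariate normal distribution. -/
def truncNormal {p : ℕ} (S : Matrix (Fin p) (Fin p) ℝ) (l u : Fin p → EReal)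
    (M : Finset (Fin p)) (μ : EuclideanSpace ℝ (Fin p)) :
    Measure (EuclideanSpace ℝ (Fin p)) :=
  (multivariateGaussian μ S)[|selectionEvent l u M]

/-- The coordinatewise conditional mean `E_μ(y_j | M)`. -/
def condMean {p : ℕ} (S : Matrix (Fin p) (Fin p) ℝ) (l u : Fin p → EReal)
    (M : Finset (Fin p)) (μ : EuclideanSpace ℝ (Fin p)) (j : Fin p) : ℝ :=
  ∫ z, z j ∂(truncNormal S l u M μ)

/-- `Φ(x; m, v)`: the distribution function at `x` of the normal law with mean `m` and
variance `v`. It is written as the probability that a centred normal variable is at most `x - m`,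
which also covers the limiting values `Φ(-∞; m, v) = 0` and `Φ(x; +∞, v) = 0`. -/
def normalCDF (x m : EReal) (v : ℝ) : ENNReal :=
  gaussianReal 0 v.toNNReal {t : ℝ | (t : EReal) ≤ x - m}

/-- For finite arguments, `normalCDF` is the usual distribution function. -/
theorem normalCDF_coe (x m v : ℝ) :
    normalCDF (x : EReal) (m : EReal) v = gaussianReal m v.toNNReal (Set.Iic x) := by
  have h : gaussianReal m v.toNNReal = (gaussianReal 0 v.toNNReal).map (· + m) := by
    rw [gaussianReal_map_add_const, zero_add]
  rw [h, Measure.map_apply (by fun_prop) measurableSet_Iic, normalCDF]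
  congr 1
  ext t
  change (t : EReal) ≤ (x : EReal) - (m : EReal) ↔ t + m ≤ x
  rw [← EReal.coe_sub, EReal.coe_le_coe_iff, le_sub_iff_add_le]

theorem normalCDF_bot (m : EReal) (v : ℝ) : normalCDF ⊥ m v = 0 := by
  simp [normalCDF]

theorem normalCDF_top (x : EReal) (v : ℝ) : normalCDF x ⊤ v = 0 := by
  simp [normalCDF]

/-- The variance of `y_j` given the other coordinates, for `y` with covariance matrix `S`:
`S_{j,j} - S_{j,-j} (S_{-j,-j})⁻¹ S_{-j,j}`. -/
def partialVar {p : ℕ} (S : Matrix (Fin p) (Fin p) ℝ) (j : Fin p) : ℝ :=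
  S j j - (fun k : {k : Fin p // k ≠ j} => S j k) ⬝ᵥ
    ((S.submatrix (fun k : {k : Fin p // k ≠ j} => (k : Fin p))
        (fun k : {k : Fin p // k ≠ j} => (k : Fin p)))⁻¹ *ᵥ
      (fun k : {k : Fin p // k ≠ j} => S k j))

/-- The estimating function: `ψ(μ)_j` is the `j`th entry of `S⁻¹ (y - E_μ(y | M))` for selected
`j`, and `y_j - μ_j` for the other `j`; here `M` is the model selected by the observation `y`. -/
def psi {p : ℕ} (S : Matrix (Fin p) (Fin p) ℝ) (l u : Fin p → EReal)
    (y μ : EuclideanSpace ℝ (Fin p)) : EuclideanSpace ℝ (Fin p) :=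
  WithLp.toLp 2 fun j =>
    if j ∈ selected l u y then
      (S⁻¹ *ᵥ fun k => y k - condMean S l u (selected l u y) μ k) j
    else y j - μ j

/-- Step sizes `γ_1, γ_2, …`: nonnegative, with divergent sum and convergent sum of squares
(`γ 0` is not used). -/
structure IsStepSize (γ : ℕ → ℝ) : Prop where
  nonneg : ∀ i, 0 ≤ γ (i + 1)
  sum_diverges : Tendsto (fun n => ∑ i ∈ Finset.range n, γ (i + 1)) atTop atTop
  summable_sq : Summable fun i => γ (i + 1) ^ 2

/-- `m i` is the `i`th iterate and `Y i` (`i ≥ 1`) the `i`th draw of the plug-in stochastic ascent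
algorithm with observation `y`, started at `m₀`. Given the past `𝓕 i`, the draw `Y (i + 1)` is
distributed according to the truncated normal law with parameter `m i`. (`Y 0` is not used.) -/
structure IsPlugInAscent {p : ℕ} {Ω : Type*} {mΩ : MeasurableSpace Ω} (P : Measure Ω)
    (𝓕 : Filtration ℕ mΩ) (S : Matrix (Fin p) (Fin p) ℝ) (l u : Fin p → EReal)
    (y m₀ : EuclideanSpace ℝ (Fin p)) (γ : ℕ → ℝ)
    (m Y : ℕ → Ω → EuclideanSpace ℝ (Fin p)) : Prop where
  init : ∀ ω, m 0 ω = m₀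
  measurable_draw : ∀ i, Measurable[𝓕 (i + 1)] (Y (i + 1))
  law_draw : ∀ i, ∀ B : Set (EuclideanSpace ℝ (Fin p)), MeasurableSet B →
    P⟦Y (i + 1) ⁻¹' B|𝓕 i⟧ =ᵐ[P]
      fun ω => (truncNormal S l u (selected l u y) (m i ω)).real B
  step_selected : ∀ i ω, ∀ j ∈ selected l u y,
    m (i + 1) ω j = m i ω j + γ (i + 1) * (S⁻¹ *ᵥ fun k => y k - Y (i + 1) ω k) j
  step_unselected : ∀ i ω, ∀ j ∉ selected l u y, m (i + 1) ω j = y j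

/-- No selected coordinate with a one-sided rule lies exactly on its only finite threshold. -/
def OffThreshold {p : ℕ} (l u : Fin p → EReal) (y : EuclideanSpace ℝ (Fin p)) : Prop :=
  ∀ j ∈ selected l u y,
    (l j = ⊥ → (y j : EReal) ≠ u j) ∧ (u j = ⊤ → (y j : EReal) ≠ l j)

end

end SelectedMeans

/-! Let Q be N(0, S) conditioned on the selection event of M. Tilting N(0, S) by exp⟪η, z⟫ gives
N(Sη, S), and tilting commutes with conditioning. Hence the truncated normal laws form the
exponential family generated by Q, with natural parameter η = S⁻¹μ (`truncNormal_eq_expTilt`).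
Fernique's theorem gives Q Gaussian tails, so all integrals below exist and depend continuously on
η.

Root of ψ. A root is a point μ of the affine space y + {w supported on M} for which the conditional
mean minus y is orthogonal to L = S⁻¹{w supported on M} (`psi_eq_zero_iff`). This is the likelihood
equation of the conditional model with μ_j = y_j fixed off M. The negative likelihood is coercive on
L because every half-space {⟪v, z - y⟫ > 0}, v ∈ L nonzero, has positive mass, which is what
`OffThreshold` provides; a minimiser is a root (`exists_inner_mean_eq`). Uniqueness holds because
the mean is strictly monotone in η (`inner_mean_sub_mean_pos`).

Convergence. The same monotonicity makes the expected step point strictly towards the root, and the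
second moment of a draw grows at most quadratically in the iterate (`exists_integral_norm_sq_le`).
The squared distance to the root is therefore an almost supermartingale. The Robbins–Siegmund
theorem makes it converge and the weighted drifts summable, and divergence of the step sum forces
the limit to be zero (`ae_tendsto_robbinsMonro`).

Variance bound. The variance is at most the second moment about μ_j, which truncation inflates by at
most one over the selection probability. That probability is bounded below by peeling off the
selected coordinates one at a time: the residual of y_k on the others is independent of them, and a
normal variable with any mean avoids (l, u) with probability at least Φ(l; u, v)
(`normalCDF_mul_measure_le`). -/

namespace SelectedMeans

open scoped RealInnerProductSpace ENNReal

/-! ### Exponential tilting, images and conditioning. -/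

section Tilting

variable {α β : Type*} {mα : MeasurableSpace α} {mβ : MeasurableSpace β}

theorem tilted_apply_eq_div {μ : Measure α} {f : α → ℝ}
    (hf : Integrable (fun x => Real.exp (f x)) μ) {B : Set α} (hB : MeasurableSet B) :
    μ.tilted f B = (∫⁻ x in B, ENNReal.ofReal (Real.exp (f x)) ∂μ) /
      ∫⁻ x, ENNReal.ofReal (Real.exp (f x)) ∂μ := by
  rw [tilted_apply' _ _ hB]
  rcases eq_zero_or_neZero μ with rfl | hμ
  · simp
  have hZ : 0 < ∫ x, Real.exp (f x) ∂μ := integral_exp_pos hf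
  have h1 : ∀ x, ENNReal.ofReal (Real.exp (f x) / ∫ x, Real.exp (f x) ∂μ) =
      ENNReal.ofReal (Real.exp (f x)) * (ENNReal.ofReal (∫ x, Real.exp (f x) ∂μ))⁻¹ := fun x => by
    rw [ENNReal.ofReal_div_of_pos hZ, div_eq_mul_inv]
  simp_rw [h1]
  rw [lintegral_mul_const' _ _ (by simp [hZ]), ← div_eq_mul_inv,
    ofReal_integral_eq_lintegral_ofReal hf (ae_of_all _ fun x => (Real.exp_pos _).le)]

theorem tilted_map {μ : Measure α} {g : α → β} (hg : Measurable g) {f : β → ℝ}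
    (hf : Measurable f) : (μ.map g).tilted f = (μ.tilted (fun x => f (g x))).map g := by
  ext B hB
  rw [tilted_apply' _ _ hB, Measure.map_apply hg hB, tilted_apply' _ _ (hg hB),
    setLIntegral_map hB (by fun_prop) hg, integral_map hg.aemeasurable (by fun_prop)]

/-- Both sides give B the ratio of ∫ exp f over A ∩ B to ∫ exp f over A; the total mass of exp f
cancels. -/
theorem cond_tilted {μ : Measure α} [IsFiniteMeasure μ] {A : Set α} (hA : MeasurableSet A)
    (hμA : μ A ≠ 0) {f : α → ℝ} (hf : Integrable (fun x => Real.exp (f x)) μ) :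
    (μ.tilted f)[|A] = (μ[|A]).tilted f := by
  have hfA : Integrable (fun x => Real.exp (f x)) (μ[|A]) :=
    hf.restrict.smul_measure (by simp [hμA])
  have hnz : ∫⁻ x, ENNReal.ofReal (Real.exp (f x)) ∂μ ≠ ⊤ := hf.lintegral_lt_top.ne
  have hpos : ∫⁻ x, ENNReal.ofReal (Real.exp (f x)) ∂μ ≠ 0 := by
    have : NeZero μ := ⟨fun h => hμA (by simp [h])⟩
    rw [← ofReal_integral_eq_lintegral_ofReal hf (ae_of_all _ fun x => (Real.exp_pos _).le)]
    simpa using integral_exp_pos hf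
  ext B hB
  rw [cond_apply hA, tilted_apply_eq_div hf hA, tilted_apply_eq_div hf (hA.inter hB),
    tilted_apply_eq_div hfA hB]
  unfold ProbabilityTheory.cond
  rw [Measure.restrict_smul, lintegral_smul_measure, lintegral_smul_measure,
    Measure.restrict_restrict hB, Set.inter_comm B A]
  simp only [smul_eq_mul]
  rw [ENNReal.mul_div_mul_left _ _ (by simp) (by simp [hμA]),
    ENNReal.inv_div (Or.inl hnz) (Or.inl hpos),
    ENNReal.div_eq_inv_mul, ENNReal.div_eq_inv_mul, ENNReal.div_eq_inv_mul, mul_assoc,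
    ← mul_assoc _ _ (∫⁻ x in A ∩ B, _ ∂μ), ENNReal.mul_inv_cancel hpos hnz, one_mul]

end Tilting

/-! ### Tilting, support and null sets of Gaussian measures. -/

section Gaussian

variable {ι : Type*} [Fintype ι]

/-- Complex exponents are needed so that one formula covers both the normalising constant (w = v)
and the characteristic function of the tilted law (w = v + it). -/
theorem integral_cexp_stdGaussian (w : ι → ℂ) :
    ∫ x, Complex.exp (∑ k, w k * (x k : ℂ)) ∂(stdGaussian (EuclideanSpace ℝ ι)) =
      Complex.exp (∑ k, w k ^ 2 / 2) := by
  rw [← map_pi_eq_stdGaussian, integral_map (by fun_prop) (by fun_prop)]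
  simp_rw [Complex.exp_sum]
  rw [integral_fintype_prod_eq_prod (f := fun k (x : ℝ) => Complex.exp (w k * (x : ℂ)))]
  refine Finset.prod_congr rfl fun k _ => ?_
  have := complexMGF_id_gaussianReal (μ := 0) (v := 1) (w k)
  simpa [complexMGF] using this

theorem integrable_exp_inner_of_isGaussian {E : Type*} [NormedAddCommGroup E]
    [InnerProductSpace ℝ E] [MeasurableSpace E] [BorelSpace E] (P : Measure E) [IsGaussian P]
    [CompleteSpace E] [SecondCountableTopology E] (v : E) :
    Integrable (fun x => Real.exp ⟪v, x⟫) P := by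
  have h1 : P.map (innerSL ℝ v) = _ := IsGaussian.map_eq_gaussianReal (innerSL ℝ v)
  have h2 := integrable_exp_mul_gaussianReal (μ := P[innerSL ℝ v])
    (v := Var[innerSL ℝ v; P].toNNReal) 1
  rw [← h1, integrable_map_measure (by fun_prop) (by fun_prop)] at h2
  simpa [Function.comp_def] using h2

/-- Cameron–Martin shift, by comparing characteristic functions: (v + it)²/2 - v²/2 = itv + (it)²/2
in each coordinate. -/
theorem stdGaussian_tilted (v : EuclideanSpace ℝ ι) :
    (stdGaussian (EuclideanSpace ℝ ι)).tilted (fun x => ⟪v, x⟫) =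
      (stdGaussian (EuclideanSpace ℝ ι)).map (fun x => v + x) := by
  have hZ : ((∫ x, Real.exp ⟪v, x⟫ ∂(stdGaussian (EuclideanSpace ℝ ι)) : ℝ) : ℂ) =
      Complex.exp (∑ k, (v k : ℂ) ^ 2 / 2) := by
    rw [← integral_cexp_stdGaussian, ← integral_complex_ofReal]
    refine integral_congr_ae (ae_of_all _ fun x => ?_)
    simp [PiLp.inner_apply, mul_comm]
  have : IsProbabilityMeasure ((stdGaussian (EuclideanSpace ℝ ι)).map (fun x => v + x)) :=
    Measure.isProbabilityMeasure_map (by fun_prop)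
  apply Measure.ext_of_charFun
  ext t
  rw [charFun_apply, charFun_apply, integral_tilted, integral_map (by fun_prop) (by fun_prop)]
  have h1 : ∀ x : EuclideanSpace ℝ ι,
      (Real.exp ⟪v, x⟫ / ∫ x, Real.exp ⟪v, x⟫ ∂(stdGaussian (EuclideanSpace ℝ ι))) •
        Complex.exp (⟪x, t⟫ * Complex.I) =
      Complex.exp (∑ k, ((v k : ℂ) + t k * Complex.I) * (x k : ℂ)) /
        Complex.exp (∑ k, (v k : ℂ) ^ 2 / 2) := fun x => by
    rw [Complex.real_smul, Complex.ofReal_div, hZ, div_mul_eq_mul_div, Complex.ofReal_exp,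
      ← Complex.exp_add]
    congr 2
    simp only [PiLp.inner_apply, RCLike.inner_apply, conj_trivial, Complex.ofReal_sum,
      Complex.ofReal_mul, Finset.sum_mul, ← Finset.sum_add_distrib]
    exact Finset.sum_congr rfl fun k _ => by ring
  have h2 : ∀ x : EuclideanSpace ℝ ι, Complex.exp (⟪v + x, t⟫ * Complex.I) =
      Complex.exp (∑ k, (v k * t k * Complex.I)) *
      Complex.exp (∑ k, (t k * Complex.I) * (x k : ℂ)) := fun x => by
    rw [← Complex.exp_add]
    congr 1
    simp only [PiLp.inner_apply, RCLike.inner_apply, conj_trivial, Complex.ofReal_sum,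
      Complex.ofReal_mul, Finset.sum_mul, ← Finset.sum_add_distrib, PiLp.add_apply,
      Complex.ofReal_add]
    exact Finset.sum_congr rfl fun k _ => by ring
  simp_rw [h1, h2]
  rw [integral_div, integral_const_mul, integral_cexp_stdGaussian, integral_cexp_stdGaussian,
    ← Complex.exp_sub, ← Complex.exp_add, ← Finset.sum_sub_distrib, ← Finset.sum_add_distrib]
  congr 1
  refine Finset.sum_congr rfl fun k _ => ?_
  ring_nf

open scoped MatrixOrder in
-- With R the square root of S, ⟪η, Rx⟫ = ⟪Rη, x⟫. The tilt thus shifts the underlying standard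
-- Gaussian by Rη, and its image under R by RRη = Sη.
theorem multivariateGaussian_tilted [DecidableEq ι] {S : Matrix ι ι ℝ} (hS : S.PosSemidef)
    (η : EuclideanSpace ℝ ι) :
    (multivariateGaussian 0 S).tilted (fun x => ⟪η, x⟫) =
      multivariateGaussian (toEuclideanCLM (𝕜 := ℝ) S η) S := by
  set R := toEuclideanCLM (𝕜 := ℝ) (CFC.sqrt S) with hR
  have hsa : IsSelfAdjoint R := (CFC.sqrt_nonneg S).isSelfAdjoint.map _
  have hRR : R (R η) = toEuclideanCLM (𝕜 := ℝ) S η := by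
    rw [← ContinuousLinearMap.comp_apply, ← ContinuousLinearMap.mul_def, hR, ← map_mul,
      CFC.sqrt_mul_sqrt_self _ hS.nonneg]
  have hin : ∀ x, ⟪η, R x⟫ = ⟪R η, x⟫ := fun x => by
    rw [← ContinuousLinearMap.adjoint_inner_left, hsa.adjoint_eq]
  unfold multivariateGaussian
  rw [← hR, tilted_map (by fun_prop) (by fun_prop)]
  simp only [zero_add, hin]
  rw [stdGaussian_tilted, Measure.map_map (by fun_prop) (by fun_prop)]
  congr 1
  ext1 x
  simp [hRR]

open scoped MatrixOrder in
theorem isOpenPosMeasure_multivariateGaussian [DecidableEq ι] {S : Matrix ι ι ℝ} (hS : S.PosDef)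
    (μ : EuclideanSpace ℝ ι) : (multivariateGaussian μ S).IsOpenPosMeasure := by
  have h0 : (gaussianReal 0 1).IsOpenPosMeasure :=
    (gaussianReal_absolutelyContinuous' 0 (v := 1) one_ne_zero).isOpenPosMeasure
  have h1 : (stdGaussian (EuclideanSpace ℝ ι)).IsOpenPosMeasure := by
    rw [← map_pi_eq_stdGaussian]
    exact (PiLp.continuous_toLp 2 (fun _ : ι => ℝ)).isOpenPosMeasure_map (WithLp.toLp_surjective 2)
  unfold multivariateGaussian
  refine Continuous.isOpenPosMeasure_map (by fun_prop) fun z => ?_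
  have hu : IsUnit (CFC.sqrt S) := by
    rw [CFC.isUnit_sqrt_iff _ hS.posSemidef.nonneg]
    exact hS.isUnit
  obtain ⟨T, hT⟩ := hu.map (toEuclideanCLM (𝕜 := ℝ))
  refine ⟨(T⁻¹ : _ˣ).val (z - μ), ?_⟩
  show μ + toEuclideanCLM (𝕜 := ℝ) (CFC.sqrt S) _ = z
  change (T : _) = toEuclideanCLM (𝕜 := ℝ) (CFC.sqrt S) at hT
  rw [← hT, ← ContinuousLinearMap.comp_apply, ← ContinuousLinearMap.mul_def, Units.mul_inv]
  simp

theorem multivariateGaussian_inner_eq_null [DecidableEq ι] {S : Matrix ι ι ℝ} (hS : S.PosDef)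
    (μ η : EuclideanSpace ℝ ι) (hη : η ≠ 0) (c : ℝ) :
    multivariateGaussian μ S {z | ⟪η, z⟫ = c} = 0 := by
  have hm : (multivariateGaussian μ S).map (innerSL ℝ η) = _ :=
    IsGaussian.map_eq_gaussianReal (innerSL ℝ η)
  have hv : 0 < Var[innerSL ℝ η; multivariateGaussian μ S] := by
    have h1 := covarianceBilin_multivariateGaussian (μ := μ) hS.posSemidef η η
    rw [covarianceBilin_self IsGaussian.memLp_two_id] at h1
    have h2 : Var[innerSL ℝ η; multivariateGaussian μ S] = η ⬝ᵥ S *ᵥ η := by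
      rw [← h1]; rfl
    rw [h2]
    have := hS.dotProduct_mulVec_pos (x := η.ofLp) (by simpa using hη)
    simpa using this
  have : NullSingletonClass (gaussianReal ((multivariateGaussian μ S)[innerSL ℝ η])
      (Var[innerSL ℝ η; multivariateGaussian μ S]).toNNReal) :=
    nullSingletonClass_gaussianReal (by simpa using hv)
  have h3 : (multivariateGaussian μ S).map (innerSL ℝ η) {c} = 0 := by
    rw [hm]; exact measure_singleton c
  rw [Measure.map_apply (by fun_prop) (measurableSet_singleton c)] at h3
  exact h3

end Gaussian

/-! ### Exponential families generated by a law with Gaussian tails. -/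

/-- Exponential square integrability of the norm. -/
def HasGaussianTail {E : Type*} [NormedAddCommGroup E] [MeasurableSpace E] (Q : Measure E) :
    Prop :=
  ∃ c : ℝ, 0 < c ∧ Integrable (fun z => Real.exp (c * ‖z‖ ^ 2)) Q

/-- The member with natural parameter `η` of the exponential family generated by `Q`. -/
noncomputable def expTilt {E : Type*} [NormedAddCommGroup E] [InnerProductSpace ℝ E]
    [MeasurableSpace E] (Q : Measure E) (η : E) : Measure E :=
  Q.tilted (fun z => ⟪η, z⟫)

section ExpFamily

variable {E : Type*} [NormedAddCommGroup E] [InnerProductSpace ℝ E] [FiniteDimensional ℝ E]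
  [MeasurableSpace E] [BorelSpace E] {Q : Measure E}

theorem HasGaussianTail.integrable_exp_mul_norm (hQ : HasGaussianTail Q) [IsFiniteMeasure Q]
    (K : ℝ) : Integrable (fun z => Real.exp (K * ‖z‖)) Q := by
  obtain ⟨c, hc, hi⟩ := hQ
  refine (hi.const_mul (Real.exp (K ^ 2 / (4 * c)))).mono' (by fun_prop) (ae_of_all _ fun z => ?_)
  rw [Real.norm_of_nonneg (Real.exp_pos _).le, ← Real.exp_add, Real.exp_le_exp]
  -- Completing the square bounds K‖z‖ by K²/(4c) + c‖z‖².
  have h : 0 ≤ (2 * c * ‖z‖ - K) ^ 2 / (4 * c) := by positivity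
  have h2 : (2 * c * ‖z‖ - K) ^ 2 / (4 * c) = K ^ 2 / (4 * c) + c * ‖z‖ ^ 2 - K * ‖z‖ := by
    field_simp; ring
  linarith

theorem HasGaussianTail.integrable_norm_pow_mul_exp (hQ : HasGaussianTail Q) [IsFiniteMeasure Q]
    (n : ℕ) (K : ℝ) : Integrable (fun z => ‖z‖ ^ n * Real.exp (K * ‖z‖)) Q := by
  refine ((hQ.integrable_exp_mul_norm (K + 1)).const_mul (n.factorial : ℝ)).mono'
    (by fun_prop) (ae_of_all _ fun z => ?_)
  rw [Real.norm_of_nonneg (by positivity), add_mul, one_mul, Real.exp_add, mul_comm (Real.exp _),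
    ← mul_assoc]
  gcongr
  have := Real.pow_div_factorial_le_exp ‖z‖ (norm_nonneg z) n
  rwa [div_le_iff₀ (by positivity), mul_comm] at this

theorem HasGaussianTail.integrable_norm_pow_mul_exp_inner (hQ : HasGaussianTail Q)
    [IsFiniteMeasure Q] (n : ℕ) (η : E) :
    Integrable (fun z => ‖z‖ ^ n * Real.exp ⟪η, z⟫) Q := by
  refine (hQ.integrable_norm_pow_mul_exp n ‖η‖).mono' (by fun_prop) (ae_of_all _ fun z => ?_)
  rw [Real.norm_of_nonneg (by positivity)]
  gcongr
  exact real_inner_le_norm η z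

theorem HasGaussianTail.integrable_exp_inner (hQ : HasGaussianTail Q) [IsFiniteMeasure Q] (η : E) :
    Integrable (fun z => Real.exp ⟪η, z⟫) Q := by
  simpa using hQ.integrable_norm_pow_mul_exp_inner 0 η

theorem HasGaussianTail.integrable_norm_pow (hQ : HasGaussianTail Q) [IsFiniteMeasure Q] (n : ℕ) :
    Integrable (fun z => ‖z‖ ^ n) Q := by
  simpa using hQ.integrable_norm_pow_mul_exp n 0

theorem HasGaussianTail.integrable_id (hQ : HasGaussianTail Q) [IsFiniteMeasure Q] :
    Integrable (fun z => z) Q :=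
  (integrable_norm_iff (by fun_prop)).1 (by simpa using hQ.integrable_norm_pow 1)

theorem HasGaussianTail.tilt (hQ : HasGaussianTail Q) (η : E) :
    HasGaussianTail (expTilt Q η) := by
  by_cases hi : Integrable (fun z => Real.exp ⟪η, z⟫) Q
  · obtain ⟨c, hc, hi'⟩ := hQ
    refine ⟨c / 2, by positivity, ?_⟩
    unfold expTilt
    rw [integrable_tilted_iff hi]
    refine (hi'.const_mul (Real.exp (‖η‖ ^ 2 / (2 * c)))).mono' (by fun_prop)
      (ae_of_all _ fun z => ?_)
    rw [smul_eq_mul, Real.norm_of_nonneg (by positivity), ← Real.exp_add, ← Real.exp_add,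
      Real.exp_le_exp]
    have h : 0 ≤ (c * ‖z‖ - ‖η‖) ^ 2 / (2 * c) := by positivity
    have h2 : (c * ‖z‖ - ‖η‖) ^ 2 / (2 * c) = ‖η‖ ^ 2 / (2 * c) + c / 2 * ‖z‖ ^ 2 - ‖η‖ * ‖z‖ := by
      field_simp; ring
    have := real_inner_le_norm η z
    linarith
  -- Without integrability the tilted measure is zero by convention.
  · refine ⟨1, one_pos, ?_⟩
    unfold expTilt
    rw [tilted_of_not_integrable hi]
    exact integrable_zero_measure

theorem HasGaussianTail.isProbabilityMeasure_expTilt (hQ : HasGaussianTail Q)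
    [IsProbabilityMeasure Q] (η : E) : IsProbabilityMeasure (expTilt Q η) :=
  isProbabilityMeasure_tilted (hQ.integrable_exp_inner η)

theorem HasGaussianTail.expTilt_expTilt (hQ : HasGaussianTail Q) [IsFiniteMeasure Q] (η v : E) :
    expTilt (expTilt Q η) v = expTilt Q (η + v) := by
  unfold expTilt
  rw [tilted_tilted (hQ.integrable_exp_inner η)]
  congr 1
  ext z
  simp [inner_add_left]

theorem HasGaussianTail.continuous_integral_exp_inner_smul (hQ : HasGaussianTail Q)
    [IsFiniteMeasure Q] {F : Type*} [NormedAddCommGroup F] [NormedSpace ℝ F] {g : E → F}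
    (hg : AEStronglyMeasurable g Q) (hb : ∀ z, ‖g z‖ ≤ 1 + ‖z‖) :
    Continuous fun η => ∫ z, Real.exp ⟪η, z⟫ • g z ∂Q := by
  rw [continuous_iff_continuousAt]
  intro η₀
  refine continuousAt_of_dominated (bound := fun z => Real.exp ((‖η₀‖ + 1) * ‖z‖) +
    ‖z‖ * Real.exp ((‖η₀‖ + 1) * ‖z‖)) ?_ ?_ ?_ ?_
  · exact Eventually.of_forall fun η =>
      AEStronglyMeasurable.smul (Continuous.aestronglyMeasurable (by fun_prop)) hg
  · filter_upwards [Metric.ball_mem_nhds η₀ one_pos] with η hη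
    refine ae_of_all _ fun z => ?_
    have h1 : ‖η‖ ≤ ‖η₀‖ + 1 := by
      have := norm_sub_norm_le η η₀
      rw [Metric.mem_ball, dist_eq_norm] at hη
      linarith
    rw [norm_smul, Real.norm_of_nonneg (Real.exp_pos _).le]
    calc Real.exp ⟪η, z⟫ * ‖g z‖ ≤ Real.exp ((‖η₀‖ + 1) * ‖z‖) * (1 + ‖z‖) := by
          gcongr
          · exact (real_inner_le_norm η z).trans (by gcongr)
          · exact hb z
      _ = _ := by ring
  · exact (hQ.integrable_exp_mul_norm _).add
      (by simpa using hQ.integrable_norm_pow_mul_exp 1 (‖η₀‖ + 1))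
  · exact ae_of_all _ fun z => Continuous.continuousAt (by fun_prop)

theorem HasGaussianTail.continuous_integral_expTilt (hQ : HasGaussianTail Q)
    [IsProbabilityMeasure Q] {F : Type*} [NormedAddCommGroup F] [NormedSpace ℝ F] {g : E → F}
    (hg : AEStronglyMeasurable g Q) (hb : ∀ z, ‖g z‖ ≤ 1 + ‖z‖) :
    Continuous fun η => ∫ z, g z ∂(expTilt Q η) := by
  have h : ∀ η, ∫ z, g z ∂(expTilt Q η) =
      (∫ z, Real.exp ⟪η, z⟫ ∂Q)⁻¹ • ∫ z, Real.exp ⟪η, z⟫ • g z ∂Q := fun η => by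
    unfold expTilt
    rw [integral_tilted, ← integral_smul]
    simp_rw [smul_smul, div_eq_inv_mul]
  simp_rw [h]
  refine Continuous.smul (Continuous.inv₀ ?_ fun η => ?_)
    (hQ.continuous_integral_exp_inner_smul hg hb)
  · simpa using hQ.continuous_integral_exp_inner_smul (g := fun _ => (1 : ℝ))
      aestronglyMeasurable_const fun z => by simp
  · exact (integral_exp_pos (hQ.integrable_exp_inner η)).ne'

theorem HasGaussianTail.continuous_mean_expTilt (hQ : HasGaussianTail Q)
    [IsProbabilityMeasure Q] : Continuous fun η => ∫ z, z ∂(expTilt Q η) :=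
  hQ.continuous_integral_expTilt (by fun_prop) fun z => by simp

/-- The mass of each measurable set is the integral of a bounded function, hence even continuous in
η. -/
theorem HasGaussianTail.measurable_expTilt (hQ : HasGaussianTail Q) [IsProbabilityMeasure Q] :
    Measurable fun η => expTilt Q η := by
  have hp := hQ.isProbabilityMeasure_expTilt
  refine Measure.measurable_of_measurable_coe _ fun B hB => ?_
  have h : ∀ η, expTilt Q η B =
      ENNReal.ofReal (∫ z, B.indicator (fun _ => (1 : ℝ)) z ∂(expTilt Q η)) := by
    intro η
    rw [integral_indicator_const _ hB]
    simp
  simp_rw [h]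
  refine (Continuous.measurable ?_).ennreal_ofReal
  refine hQ.continuous_integral_expTilt
    (measurable_const.indicator hB).aestronglyMeasurable fun z => ?_
  refine (norm_indicator_le_norm_self _ _).trans ?_
  simp

/-- Chebyshev's association inequality for X and exp X. With c the mean of X, the covariance is the
integral of (exp X - exp c)(X - c) ≥ 0, whose integrand vanishes only where X = c. -/
theorem integral_mul_integral_exp_lt {Ω : Type*} {mΩ : MeasurableSpace Ω} {P : Measure Ω}
    [IsProbabilityMeasure P] {X : Ω → ℝ} (hX : Integrable X P)
    (hE : Integrable (fun ω => Real.exp (X ω)) P)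
    (hXE : Integrable (fun ω => Real.exp (X ω) * X ω) P) (hne : ∀ c : ℝ, ¬ ∀ᵐ ω ∂P, X ω = c) :
    (∫ ω, X ω ∂P) * ∫ ω, Real.exp (X ω) ∂P < ∫ ω, Real.exp (X ω) * X ω ∂P := by
  set c := ∫ ω, X ω ∂P with hc
  have hpos : ∀ x : ℝ, 0 ≤ (Real.exp x - Real.exp c) * (x - c) := fun x => by
    rcases le_total x c with h | h
    · exact mul_nonneg_of_nonpos_of_nonpos (by simpa using h) (by linarith)
    · exact mul_nonneg (by simpa using h) (by linarith)
  have hexp : ∀ ω, (Real.exp (X ω) - Real.exp c) * (X ω - c) =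
      Real.exp (X ω) * X ω - c * Real.exp (X ω) - Real.exp c * (X ω - c) := fun ω => by ring
  have hi1 : Integrable (fun ω => Real.exp (X ω) * X ω - c * Real.exp (X ω)) P :=
    hXE.sub (hE.const_mul c)
  have hi2 : Integrable (fun ω => Real.exp c * (X ω - c)) P :=
    (hX.sub (integrable_const c)).const_mul _
  have hint : Integrable (fun ω => (Real.exp (X ω) - Real.exp c) * (X ω - c)) P := by
    simp_rw [hexp]; exact hi1.sub hi2
  have h0 : 0 < ∫ ω, (Real.exp (X ω) - Real.exp c) * (X ω - c) ∂P := by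
    refine lt_of_le_of_ne (integral_nonneg fun ω => hpos _) fun h => hne c ?_
    have := (integral_eq_zero_iff_of_nonneg (fun ω => hpos (X ω)) hint).1 h.symm
    filter_upwards [this] with ω hω
    rcases mul_eq_zero.1 hω with h | h
    · exact Real.exp_injective (sub_eq_zero.1 h)
    · exact sub_eq_zero.1 h
  simp_rw [hexp] at h0
  rw [integral_sub hi1 hi2, integral_sub hXE (hE.const_mul c), integral_const_mul,
    integral_const_mul, integral_sub hX (integrable_const c)] at h0
  simp only [integral_const, probReal_univ, one_smul, ← hc, sub_self, mul_zero, sub_zero] at h0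
  linarith

/-- The law at η' is the tilt of the law at η by X = ⟪η' - η, ·⟫, so the claim is that tilting a
nonconstant variable by its own exponential raises its mean. -/
theorem HasGaussianTail.inner_mean_sub_mean_pos (hQ : HasGaussianTail Q) [IsProbabilityMeasure Q]
    {η η' : E} (hne : ∀ c : ℝ, ¬ ∀ᵐ z ∂Q, ⟪η' - η, z⟫ = c) :
    0 < ⟪η' - η, (∫ z, z ∂(expTilt Q η')) - ∫ z, z ∂(expTilt Q η)⟫ := by
  have hp := hQ.isProbabilityMeasure_expTilt
  have ht := hQ.tilt
  have hE := (ht η).integrable_exp_inner (η' - η)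
  have h1 : Integrable (fun z => ⟪η' - η, z⟫) (expTilt Q η) :=
    (ht η).integrable_id.const_inner _
  have h2 : Integrable (fun z => Real.exp ⟪η' - η, z⟫ * ⟪η' - η, z⟫)
      (expTilt Q η) := by
    refine (((ht η).integrable_norm_pow_mul_exp_inner 1 (η' - η)).const_mul ‖η' - η‖).mono'
      (by fun_prop) (ae_of_all _ fun z => ?_)
    rw [norm_mul, Real.norm_of_nonneg (Real.exp_pos _).le, pow_one, mul_comm, ← mul_assoc]
    gcongr
    exact norm_inner_le_norm _ _
  have key := integral_mul_integral_exp_lt h1 hE h2 fun c h => hne c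
    ((absolutelyContinuous_tilted (hQ.integrable_exp_inner η)).ae_le h)
  have hη' : expTilt Q η' =
      expTilt (expTilt Q η) (η' - η) := by
    rw [hQ.expTilt_expTilt]; simp
  rw [inner_sub_right, ← integral_inner (ht η').integrable_id, ← integral_inner (ht η).integrable_id,
    sub_pos]
  rw [hη', show expTilt (expTilt Q η) (η' - η) =
    (expTilt Q η).tilted (fun z => ⟪η' - η, z⟫) from rfl, integral_tilted]
  simp only [smul_eq_mul, div_mul_eq_mul_div]
  rw [integral_div, lt_div_iff₀ (integral_exp_pos hE)]
  exact key

/-- Let b be the mean norm under Q. The normalising constant is at least exp(-b‖η‖), by the tangent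
line of exp at -b‖η‖. Since ‖η‖‖z‖ ≤ ‖η‖²/(2c) + c‖z‖²/2, the choice a = ‖η‖²/(2c) + b‖η‖ keeps the
tilted mean of exp(c‖z‖²/2 - a) below the constant K. As x ≤ exp x, the second moment is at most 2(a
+ K)/c, and a is quadratic in ‖η‖. -/
theorem HasGaussianTail.exists_integral_norm_sq_le (hQ : HasGaussianTail Q)
    [IsProbabilityMeasure Q] :
    ∃ C : ℝ, 0 ≤ C ∧ ∀ η, ∫ z, ‖z‖ ^ 2 ∂(expTilt Q η) ≤ C * (1 + ‖η‖ ^ 2) := by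
  have hQ' := hQ
  have hp := hQ.isProbabilityMeasure_expTilt
  obtain ⟨c, hc, hi⟩ := hQ
  set K := ∫ z, Real.exp (c * ‖z‖ ^ 2) ∂Q with hK
  set b := ∫ z, ‖z‖ ∂Q with hb
  have hK0 : 0 ≤ K := integral_nonneg fun z => (Real.exp_pos _).le
  have hb0 : 0 ≤ b := integral_nonneg fun z => norm_nonneg _
  refine ⟨2 / c * (1 / (2 * c) + b + K), by positivity, fun η => ?_⟩
  set a := ‖η‖ ^ 2 / (2 * c) + b * ‖η‖ with ha
  have hZ : Real.exp (-(b * ‖η‖)) ≤ ∫ z, Real.exp ⟪η, z⟫ ∂Q := by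
    have h1 : ∀ z, Real.exp (-(b * ‖η‖)) * (1 + b * ‖η‖ - ‖η‖ * ‖z‖) ≤ Real.exp ⟪η, z⟫ := fun z => by
      have h2 : ⟪η, z⟫ = -(b * ‖η‖) + (b * ‖η‖ + ⟪η, z⟫) := by ring
      rw [h2, Real.exp_add]
      gcongr
      have h3 := Real.add_one_le_exp (b * ‖η‖ + ⟪η, z⟫)
      have h4 := neg_le_of_abs_le (abs_real_inner_le_norm η z)
      linarith
    have hn : Integrable (fun z => ‖z‖) Q := by simpa using hQ'.integrable_norm_pow 1
    have h5 : Integrable (fun z => Real.exp (-(b * ‖η‖)) * (1 + b * ‖η‖ - ‖η‖ * ‖z‖)) Q :=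
      ((integrable_const _).sub (hn.const_mul _)).const_mul _
    have h6 := integral_mono h5 (hQ'.integrable_exp_inner η) h1
    rw [integral_const_mul, integral_sub (integrable_const _) (hn.const_mul _),
      integral_const_mul, ← hb] at h6
    simp only [integral_const, probReal_univ, one_smul] at h6
    calc Real.exp (-(b * ‖η‖)) = Real.exp (-(b * ‖η‖)) * (1 + b * ‖η‖ - ‖η‖ * b) := by ring
      _ ≤ _ := h6
  have hdom : ∀ z : E, Real.exp ⟪η, z⟫ * Real.exp (c / 2 * ‖z‖ ^ 2 - a) ≤
      Real.exp (-(b * ‖η‖)) * Real.exp (c * ‖z‖ ^ 2) := fun z => by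
    rw [← Real.exp_add, ← Real.exp_add, Real.exp_le_exp]
    have h : 0 ≤ (c * ‖z‖ - ‖η‖) ^ 2 / (2 * c) := by positivity
    have h2 : (c * ‖z‖ - ‖η‖) ^ 2 / (2 * c) = ‖η‖ ^ 2 / (2 * c) + c / 2 * ‖z‖ ^ 2 - ‖η‖ * ‖z‖ := by
      field_simp; ring
    have := real_inner_le_norm η z
    linarith
  have hi3 : Integrable (fun z => Real.exp ⟪η, z⟫ * Real.exp (c / 2 * ‖z‖ ^ 2 - a)) Q :=
    (hi.const_mul (Real.exp (-(b * ‖η‖)))).mono' (by fun_prop) (ae_of_all _ fun z => by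
      rw [Real.norm_of_nonneg (by positivity)]; exact hdom z)
  have hi4 : Integrable (fun z => Real.exp (c / 2 * ‖z‖ ^ 2 - a)) (expTilt Q η) := by
    unfold expTilt
    rw [integrable_tilted_iff (hQ'.integrable_exp_inner η)]
    exact hi3
  have hsec : ∫ z, Real.exp (c / 2 * ‖z‖ ^ 2 - a) ∂(expTilt Q η) ≤ K := by
    unfold expTilt
    rw [integral_tilted]
    simp only [smul_eq_mul, div_mul_eq_mul_div (Real.exp ⟪η, _⟫)]
    rw [integral_div, div_le_iff₀ (integral_exp_pos (hQ'.integrable_exp_inner η))]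
    calc _ ≤ ∫ z, Real.exp (-(b * ‖η‖)) * Real.exp (c * ‖z‖ ^ 2) ∂Q :=
          integral_mono hi3 (hi.const_mul _) hdom
      _ = K * Real.exp (-(b * ‖η‖)) := by rw [integral_const_mul, mul_comm]
      _ ≤ K * _ := by gcongr
  have hfin : c / 2 * ∫ z, ‖z‖ ^ 2 ∂(expTilt Q η) ≤ a + K := by
    rw [← integral_const_mul]
    calc _ ≤ ∫ z, (a + Real.exp (c / 2 * ‖z‖ ^ 2 - a)) ∂(expTilt Q η) := by
          refine integral_mono (((hQ'.tilt η).integrable_norm_pow 2).const_mul _)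
            ((integrable_const _).add hi4) fun z => ?_
          have := Real.add_one_le_exp (c / 2 * ‖z‖ ^ 2 - a)
          simp only
          linarith
      _ ≤ a + K := by
          rw [integral_add (integrable_const _) hi4]
          simp only [integral_const, probReal_univ, one_smul]
          linarith
  have haK : a + K ≤ (1 / (2 * c) + b + K) * (1 + ‖η‖ ^ 2) := by
    have h1 : ‖η‖ ≤ 1 + ‖η‖ ^ 2 := by nlinarith [sq_nonneg (‖η‖ - 1), norm_nonneg η]
    have h2 : b * ‖η‖ ≤ b * (1 + ‖η‖ ^ 2) := by gcongr
    have h3 : K * 1 ≤ K * (1 + ‖η‖ ^ 2) := by gcongr; nlinarith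
    have h4 : ‖η‖ ^ 2 / (2 * c) ≤ 1 / (2 * c) * (1 + ‖η‖ ^ 2) := by
      rw [one_div, inv_mul_eq_div]; gcongr; linarith
    nlinarith
  calc ∫ z, ‖z‖ ^ 2 ∂(expTilt Q η)
      = 2 / c * (c / 2 * ∫ z, ‖z‖ ^ 2 ∂(expTilt Q η)) := by field_simp
    _ ≤ 2 / c * ((1 / (2 * c) + b + K) * (1 + ‖η‖ ^ 2)) :=
        mul_le_mul_of_nonneg_left (hfin.trans haK) (by positivity)
    _ = _ := by ring

/-- The function F(v) = ∫ exp⟪v, z - y⟫ dQ on L is coercive, so it has a minimiser; the vanishing of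
its directional derivatives there is the required equation. -/
theorem HasGaussianTail.exists_inner_mean_eq_of_base (hQ : HasGaussianTail Q)
    [IsProbabilityMeasure Q] (L : Submodule ℝ E) (y : E)
    (hpos : ∀ v ∈ L, v ≠ 0 → Q {z | 0 < ⟪v, z - y⟫} ≠ 0) :
    ∃ v ∈ L, ∀ w ∈ L, ⟪w, (∫ z, z ∂(expTilt Q v)) - y⟫ = 0 := by
  have hp := hQ.isProbabilityMeasure_expTilt
  have hzy : Integrable (fun z => z - y) Q := hQ.integrable_id.sub (integrable_const y)
  have hExp : ∀ v : E, Integrable (fun z => Real.exp ⟪v, z - y⟫) Q := fun v => by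
    simp_rw [inner_sub_right, Real.exp_sub]
    exact (hQ.integrable_exp_inner v).div_const _
  set F : L → ℝ := fun v => ∫ z, Real.exp ⟪(v : E), z - y⟫ ∂Q with hF
  set G : L → ℝ := fun v => ∫ z, max ⟪(v : E), z - y⟫ 0 ∂Q with hG
  have hGi : ∀ v : L, Integrable (fun z => max ⟪(v : E), z - y⟫ 0) Q := fun v =>
    (hzy.const_inner (v : E)).pos_part
  have hFc : Continuous F := by
    have h1 : ∀ v : L, F v = (∫ z, Real.exp ⟪(v : E), z⟫ ∂Q) / Real.exp ⟪(v : E), y⟫ := fun v => by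
      simp only [hF, inner_sub_right, Real.exp_sub, integral_div]
    simp_rw [funext h1]
    refine Continuous.div ?_ (by fun_prop) fun v => (Real.exp_pos _).ne'
    have := hQ.continuous_integral_exp_inner_smul (g := fun _ => (1 : ℝ))
      aestronglyMeasurable_const fun z => by simp
    simp only [smul_eq_mul, mul_one] at this
    exact this.comp continuous_subtype_val
  have hGc : Continuous G := by
    rw [continuous_iff_continuousAt]
    intro v₀
    refine continuousAt_of_dominated (bound := fun z => (‖v₀‖ + 1) * ‖z - y‖) ?_ ?_ ?_ ?_
    · exact Eventually.of_forall fun v => (hGi v).aestronglyMeasurable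
    · filter_upwards [Metric.ball_mem_nhds v₀ one_pos] with v hv
      refine ae_of_all _ fun z => ?_
      have h1 : ‖v‖ ≤ ‖v₀‖ + 1 := by
        have := norm_sub_norm_le v v₀
        rw [Metric.mem_ball, dist_eq_norm] at hv
        linarith
      rw [Real.norm_of_nonneg (le_max_right _ _)]
      refine max_le ((real_inner_le_norm _ _).trans ?_) (by positivity)
      gcongr
      exact h1
    · exact hzy.norm.const_mul _
    · exact ae_of_all _ fun z => Continuous.continuousAt (by fun_prop)
  have hGpos : ∀ v ∈ Metric.sphere (0 : L) 1, 0 < G v := fun v hv => by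
    have hv0 : (v : E) ≠ 0 := by
      intro h
      have : v = 0 := Subtype.ext h
      simp [this] at hv
    refine (integral_pos_iff_support_of_nonneg (fun z => le_max_right _ _) (hGi v)).2 ?_
    refine lt_of_lt_of_le (pos_iff_ne_zero.2 (hpos v v.2 hv0)) (measure_mono fun z hz => ?_)
    simp only [Function.mem_support]
    exact (lt_max_of_lt_left hz).ne'
  obtain ⟨δ, hδ, hGδ⟩ := (isCompact_sphere (0 : L) 1).exists_forall_le' hGc.continuousOn hGpos
  -- Coercivity: max(t, 0) ≤ exp t gives G ≤ F, and G is positively homogeneous and at least δ on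
  -- the unit sphere.
  have hFG : ∀ v, δ * ‖v‖ ≤ F v := fun v => by
    have h1 : G v ≤ F v := integral_mono (hGi v) (hExp v) fun z =>
      max_le ((Real.add_one_le_exp _).trans' (by linarith)) (Real.exp_pos _).le
    refine le_trans ?_ h1
    rcases eq_or_ne v 0 with rfl | hv
    · simp [hG]
    · have hn : 0 < ‖v‖ := norm_pos_iff.2 hv
      have h2 : G v = ‖v‖ * G (‖v‖⁻¹ • v) := by
        simp only [hG]
        rw [← integral_const_mul]
        refine integral_congr_ae (ae_of_all _ fun z => ?_)
        simp only [Submodule.coe_smul, real_inner_smul_left]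
        rw [mul_max_of_nonneg _ _ hn.le, mul_zero, ← mul_assoc, mul_inv_cancel₀ hn.ne', one_mul]
      rw [h2, mul_comm]
      gcongr
      exact hGδ _ (by rw [mem_sphere_zero_iff_norm, norm_smul, norm_inv, norm_norm,
        inv_mul_cancel₀ hn.ne'])
  have hcoer : Tendsto F (cocompact L) atTop :=
    tendsto_atTop_mono hFG (tendsto_norm_cocompact_atTop.const_mul_atTop hδ)
  obtain ⟨v, hv⟩ := hFc.exists_forall_le hcoer
  refine ⟨v, v.2, fun w hw => ?_⟩
  set P := expTilt Q (v : E) with hP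
  set X : E → ℝ := fun z => ⟪w, z - y⟫ with hX
  have hint : ∀ t, t ∈ integrableExpSet X P := fun t => by
    have h1 : (fun z => Real.exp (t * X z)) =
        fun z => Real.exp ⟪t • w, z⟫ / Real.exp (t * ⟪w, y⟫) := by
      ext z
      rw [← Real.exp_sub, hX]
      simp only [inner_sub_right, real_inner_smul_left]
      ring_nf
    show Integrable _ P
    rw [h1]
    exact ((hQ.tilt v).integrable_exp_inner _).div_const _
  -- Along the line v + tw, F is up to a constant the moment generating function of ⟪w, z - y⟫ under
  -- the tilt at v, so its derivative at 0 is the mean.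
  have hmgf : ∀ t : ℝ, mgf X P t = F (v + t • ⟨w, hw⟩) / F v := fun t => by
    have hFv : ∫ z, Real.exp ⟪(v : E), z⟫ ∂Q = Real.exp ⟪(v : E), y⟫ * F v := by
      simp only [hF]
      rw [← integral_const_mul]
      refine integral_congr_ae (ae_of_all _ fun z => ?_)
      simp only [← Real.exp_add, inner_sub_right]
      ring_nf
    have h1 : mgf X P t = ∫ z, (Real.exp ⟪(v : E), z⟫ / ∫ z, Real.exp ⟪(v : E), z⟫ ∂Q) •
        Real.exp (t * X z) ∂Q := by
      rw [mgf, hP]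
      unfold expTilt
      rw [integral_tilted]
    rw [h1, hFv]
    simp only [hF]
    rw [← integral_div]
    refine integral_congr_ae (ae_of_all _ fun z => ?_)
    simp only [smul_eq_mul]
    rw [← div_div, ← Real.exp_sub, div_mul_eq_mul_div, ← Real.exp_add]
    congr 2
    simp only [hX, Submodule.coe_add, Submodule.coe_smul, inner_add_left, inner_sub_right,
      real_inner_smul_left]
    ring
  have hder : HasDerivAt (mgf X P) (P[X]) 0 := by
    have := hasDerivAt_mgf (X := X) (μ := P) (t := 0)
      (by rw [show integrableExpSet X P = Set.univ from Set.eq_univ_of_forall hint]; simp)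
    simpa using this
  have hmin : IsLocalMin (mgf X P) 0 := by
    refine Eventually.of_forall fun t => ?_
    rw [hmgf, hmgf]
    have : 0 < F v := integral_exp_pos (hExp v)
    gcongr
    simpa using hv _
  have h0 := hmin.hasDerivAt_eq_zero hder
  have hi := (hQ.tilt (v : E)).integrable_id
  rw [← hP] at hi
  simp only [hX] at h0
  have h3 : ∫ z, ⟪w, z - y⟫ ∂P = ⟪w, ∫ z, (z - y) ∂P⟫ := integral_inner (hi.sub (integrable_const y)) w
  rw [h3, integral_sub hi (integrable_const y)] at h0
  simpa using h0

/-- Rebasing the family at η₀ is harmless: the tilted law has the same null sets, so the half-spaces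
keep positive mass. -/
theorem HasGaussianTail.exists_inner_mean_eq (hQ : HasGaussianTail Q)
    [IsProbabilityMeasure Q] (L : Submodule ℝ E) (y η₀ : E)
    (hpos : ∀ v ∈ L, v ≠ 0 → Q {z | 0 < ⟪v, z - y⟫} ≠ 0) :
    ∃ v ∈ L, ∀ w ∈ L, ⟪w, (∫ z, z ∂(expTilt Q (η₀ + v))) - y⟫ = 0 := by
  have hp := hQ.isProbabilityMeasure_expTilt η₀
  simp_rw [← hQ.expTilt_expTilt η₀]
  exact (hQ.tilt η₀).exists_inner_mean_eq_of_base L y fun v hv hv0 h =>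
    hpos v hv hv0 (absolutelyContinuous_tilted (hQ.integrable_exp_inner η₀) h)

end ExpFamily

/-! ### Almost supermartingales and the deterministic end of the convergence argument. -/

section StochasticApproximation

theorem exists_tendsto_prod_one_add {a : ℕ → ℝ} (ha : ∀ n, 0 ≤ a n) (hs : Summable a) :
    ∃ C, 0 < C ∧ Tendsto (fun n => ∏ i ∈ Finset.range n, (1 + a i)) atTop (𝓝 C) := by
  have h1 : ∀ n, 1 ≤ ∏ i ∈ Finset.range n, (1 + a i) := fun n =>
    Finset.one_le_prod fun i _ => by linarith [ha i]
  have hm : Monotone fun n => ∏ i ∈ Finset.range n, (1 + a i) := by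
    refine monotone_nat_of_le_succ fun n => ?_
    rw [Finset.prod_range_succ]
    exact le_mul_of_one_le_right (by linarith [h1 n]) (by linarith [ha n])
  have hb : BddAbove (Set.range fun n => ∏ i ∈ Finset.range n, (1 + a i)) := by
    refine ⟨Real.exp (∑' i, a i), ?_⟩
    rintro _ ⟨n, rfl⟩
    calc ∏ i ∈ Finset.range n, (1 + a i) ≤ ∏ i ∈ Finset.range n, Real.exp (a i) :=
          Finset.prod_le_prod (fun i _ => by linarith [ha i])
            fun i _ => by linarith [Real.add_one_le_exp (a i)]
      _ = Real.exp (∑ i ∈ Finset.range n, a i) := (Real.exp_sum _ _).symm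
      _ ≤ _ := Real.exp_le_exp.2 (hs.sum_le_tsum _ fun i _ => ha i)
  have ht := tendsto_atTop_ciSup hm hb
  exact ⟨_, lt_of_lt_of_le one_pos (ge_of_tendsto' ht h1), ht⟩

theorem exists_tendsto_of_nonneg_supermartingale {Ω : Type*} {mΩ : MeasurableSpace Ω}
    {P : Measure Ω} [IsFiniteMeasure P] {𝓕 : Filtration ℕ mΩ} {U : ℕ → Ω → ℝ}
    (hU : Supermartingale U 𝓕 P) (h0 : ∀ n ω, 0 ≤ U n ω) :
    ∀ᵐ ω ∂P, ∃ c, Tendsto (fun n => U n ω) atTop (𝓝 c) := by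
  have hb : ∀ n, eLpNorm ((-U) n) 1 P ≤ ((∫ ω, U 0 ω ∂P).toNNReal : ℝ≥0∞) := fun n => by
    have h1 : ∫ ω, U n ω ∂P ≤ ∫ ω, U 0 ω ∂P := by
      simpa using hU.setIntegral_le (Nat.zero_le n) MeasurableSet.univ
    rw [Pi.neg_apply, eLpNorm_neg, eLpNorm_one_eq_lintegral_enorm,
      ← ofReal_integral_norm_eq_lintegral_enorm (hU.integrable n)]
    simp_rw [Real.norm_of_nonneg (h0 n _)]
    exact ENNReal.ofReal_le_ofReal h1
  filter_upwards [hU.neg.exists_ae_tendsto_of_bdd hb] with ω ⟨c, hc⟩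
  exact ⟨-c, by simpa using hc.neg⟩

/-- The Robbins–Siegmund almost supermartingale convergence theorem. -/
theorem ae_tendsto_and_summable_of_almost_supermartingale {Ω : Type*} {mΩ : MeasurableSpace Ω}
    {P : Measure Ω} [IsFiniteMeasure P] {𝓕 : Filtration ℕ mΩ} {V D : ℕ → Ω → ℝ} {a g : ℕ → ℝ}
    (hV : StronglyAdapted 𝓕 V) (hVi : ∀ n, Integrable (V n) P) (hV0 : ∀ n ω, 0 ≤ V n ω)
    (hD : StronglyAdapted 𝓕 D) (hDi : ∀ n, Integrable (D n) P) (hD0 : ∀ n ω, 0 ≤ D n ω)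
    (ha : ∀ n, 0 ≤ a n) (has : Summable a) (hg : ∀ n, 0 ≤ g n)
    (hrec : ∀ n, P[V (n + 1)|𝓕 n] ≤ᵐ[P] fun ω => (1 + a n) * V n ω + a n - g n * D n ω) :
    ∀ᵐ ω ∂P, (∃ v, Tendsto (fun n => V n ω) atTop (𝓝 v)) ∧ Summable fun n => g n * D n ω := by
  obtain ⟨C, hC, hlim⟩ := exists_tendsto_prod_one_add ha has
  set π : ℕ → ℝ := fun n => ∏ i ∈ Finset.range n, (1 + a i) with hπ
  have hπs : ∀ n, π (n + 1) = π n * (1 + a n) := fun n => Finset.prod_range_succ _ _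
  have hπ0 : ∀ n, 0 < π n := fun n => Finset.prod_pos fun i _ => by linarith [ha i]
  have hπC : ∀ n, π n ≤ C := fun n => by
    refine (monotone_nat_of_le_succ fun n => ?_).ge_of_tendsto hlim n
    show π n ≤ π (n + 1)
    rw [hπs]
    exact le_mul_of_one_le_right (hπ0 n).le (by linarith [ha n])
  set T : ℕ → Ω → ℝ := fun n ω => ∑ i ∈ Finset.range n, g i * D i ω / π (i + 1) with hT
  -- Adding 1 absorbs the additive error, since (1 + a)V + a + 1 = (1 + a)(V + 1). Dividing by π
  -- removes the factor 1 + a, and T restores the drift, so U is a true supermartingale.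
  set U : ℕ → Ω → ℝ := fun n ω => (V n ω + 1) / π n + T n ω with hUdef
  have hterm : ∀ i ω, 0 ≤ g i * D i ω / π (i + 1) := fun i ω =>
    div_nonneg (mul_nonneg (hg i) (hD0 i ω)) (hπ0 _).le
  have hT0 : ∀ n ω, 0 ≤ T n ω := fun n ω => Finset.sum_nonneg fun i _ => hterm i ω
  have hTi : ∀ n, Integrable (T n) P := fun n =>
    integrable_finsetSum _ fun i _ => ((hDi i).const_mul _).div_const _
  have hTm : ∀ n, StronglyMeasurable[𝓕 n] (T (n + 1)) := fun n => by
    refine Finset.stronglyMeasurable_fun_sum _ fun i hi => ?_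
    have hin : i ≤ n := Nat.lt_succ_iff.1 (Finset.mem_range.1 hi)
    exact (((hD i).mono (𝓕.mono hin)).const_mul _).div stronglyMeasurable_const
  have hTm' : ∀ n, StronglyMeasurable[𝓕 n] (T n) := fun n => by
    refine Finset.stronglyMeasurable_fun_sum _ fun i hi => ?_
    exact (((hD i).mono (𝓕.mono (Finset.mem_range.1 hi).le)).const_mul _).div
      stronglyMeasurable_const
  have hUa : StronglyAdapted 𝓕 U := fun n =>
    (((hV n).add stronglyMeasurable_const).div stronglyMeasurable_const).add (hTm' n)
  have hU1i : ∀ n, Integrable (fun ω => (V n ω + 1) / π n) P := fun n =>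
    ((hVi n).add (integrable_const 1)).div_const _
  have hUi : ∀ n, Integrable (U n) P := fun n => (hU1i n).add (hTi n)
  have hU0 : ∀ n ω, 0 ≤ U n ω := fun n ω =>
    add_nonneg (div_nonneg (by linarith [hV0 n ω]) (hπ0 n).le) (hT0 n ω)
  have hsuper : Supermartingale U 𝓕 P := by
    refine supermartingale_nat hUa hUi fun n => ?_
    have e1 : U (n + 1) = (π (n + 1))⁻¹ • V (n + 1) + fun ω => (π (n + 1))⁻¹ + T (n + 1) ω := by
      ext ω
      simp only [hUdef, Pi.add_apply, Pi.smul_apply, smul_eq_mul]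
      ring
    have hm2 : StronglyMeasurable[𝓕 n] (fun ω => (π (n + 1))⁻¹ + T (n + 1) ω) :=
      stronglyMeasurable_const.add (hTm n)
    have hi2 : Integrable (fun ω => (π (n + 1))⁻¹ + T (n + 1) ω) P :=
      (integrable_const _).add (hTi _)
    have e2 : P[U (n + 1)|𝓕 n] =ᵐ[P]
        fun ω => (π (n + 1))⁻¹ * P[V (n + 1)|𝓕 n] ω + ((π (n + 1))⁻¹ + T (n + 1) ω) := by
      rw [e1]
      filter_upwards [condExp_add ((hVi (n + 1)).smul (π (n + 1))⁻¹) hi2 (𝓕 n),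
        condExp_smul (π (n + 1))⁻¹ (V (n + 1)) (𝓕 n) (μ := P)] with ω h1 h2
      rw [h1, Pi.add_apply, h2, condExp_of_stronglyMeasurable (𝓕.le n) hm2 hi2]
      rfl
    filter_upwards [e2, hrec n] with ω h1 h2
    rw [h1]
    have h3 : (π (n + 1))⁻¹ * P[V (n + 1)|𝓕 n] ω ≤
        (π (n + 1))⁻¹ * ((1 + a n) * V n ω + a n - g n * D n ω) :=
      mul_le_mul_of_nonneg_left h2 (inv_nonneg.2 (hπ0 _).le)
    have h4 : T (n + 1) ω = T n ω + g n * D n ω / π (n + 1) := Finset.sum_range_succ _ _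
    have h5 : (π (n + 1))⁻¹ * ((1 + a n) * V n ω + a n - g n * D n ω) + ((π (n + 1))⁻¹ +
        (T n ω + g n * D n ω / π (n + 1))) = (V n ω + 1) / π n + T n ω := by
      have h6 : (1 + a n) ≠ 0 := by linarith [ha n]
      have h7 := (hπ0 n).ne'
      rw [hπs]
      field_simp
      ring
    rw [h4]
    linarith
  filter_upwards [exists_tendsto_of_nonneg_supermartingale hsuper hU0] with ω ⟨c, hc⟩
  have hbd := hc.bddAbove_range
  obtain ⟨b, hb⟩ := hbd
  have hTs : Summable fun n => g n * D n ω / π (n + 1) := by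
    refine summable_of_sum_range_le (c := b) (fun n => hterm n ω) fun n => ?_
    refine le_trans ?_ (hb ⟨n, rfl⟩)
    have : 0 ≤ (V n ω + 1) / π n := div_nonneg (by linarith [hV0 n ω]) (hπ0 n).le
    simp only [hUdef, hT]
    linarith
  constructor
  · have h1 := (hc.sub hTs.hasSum.tendsto_sum_nat).mul hlim
    refine ⟨_, (h1.sub_const 1).congr fun n => ?_⟩
    have := (hπ0 n).ne'
    simp only [hUdef, hT, add_sub_cancel_right]
    field_simp
    ring
  · refine Summable.of_nonneg_of_le (fun n => mul_nonneg (hg n) (hD0 n ω)) (fun n => ?_)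
      (hTs.mul_left C)
    rw [← mul_div_assoc, le_div_iff₀ (hπ0 _), mul_comm]
    exact mul_le_mul_of_nonneg_right (hπC _) (mul_nonneg (hg n) (hD0 n ω))

/-- If v were positive, x would eventually stay in a compact shell around x₀ on which φ is bounded
below, making g summable. -/
theorem tendsto_of_tendsto_norm_of_summable {E : Type*} [NormedAddCommGroup E] [ProperSpace E]
    {H : Set E} (hH : IsClosed H) {φ : E → ℝ} (hφ : Continuous φ) {x₀ : E}
    (hpos : ∀ x ∈ H, x ≠ x₀ → 0 < φ x) {g : ℕ → ℝ} (hg : ∀ n, 0 ≤ g n)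
    (hdiv : ¬ Summable g) {x : ℕ → E} (hx : ∀ n, x n ∈ H) {v : ℝ}
    (hv : Tendsto (fun n => ‖x n - x₀‖ ^ 2) atTop (𝓝 v)) (hs : Summable fun n => g n * φ (x n)) :
    Tendsto x atTop (𝓝 x₀) := by
  have hv0 : 0 ≤ v := ge_of_tendsto' hv fun n => by positivity
  rcases hv0.eq_or_lt with rfl | hvpos
  · rw [tendsto_iff_norm_sub_tendsto_zero]
    have := hv.sqrt
    simpa [Real.sqrt_sq (norm_nonneg _)] using this
  exfalso
  -- The radius v + 1 suffices because it is at least 1: a squared distance below v + 1 then forces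
  -- a distance below v + 1.
  set K : Set E := (Metric.closedBall x₀ (v + 1) ∩ H) ∩ {z | v / 2 ≤ ‖z - x₀‖ ^ 2} with hK
  have hKc : IsCompact K := ((isCompact_closedBall x₀ (v + 1)).inter_right hH).inter_right
    (isClosed_le continuous_const (by fun_prop))
  obtain ⟨δ, hδ, hφδ⟩ := hKc.exists_forall_le' hφ.continuousOn (a := 0) fun z hz => by
    refine hpos z hz.1.2 ?_
    rintro rfl
    have := hz.2
    simp at this
    linarith
  have hev : ∀ᶠ n in atTop, x n ∈ K := by
    filter_upwards [hv.eventually (lt_mem_nhds (half_lt_self hvpos)),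
      hv.eventually (gt_mem_nhds (lt_add_one v))] with n h1 h2
    refine ⟨⟨?_, hx n⟩, h1.le⟩
    rw [Metric.mem_closedBall, dist_eq_norm]
    by_contra! h
    nlinarith
  obtain ⟨N, hN⟩ := eventually_atTop.1 hev
  refine hdiv ((summable_nat_add_iff N).1 ?_)
  refine Summable.of_nonneg_of_le (fun n => hg _) (fun n => ?_)
    (((summable_nat_add_iff N).2 hs).mul_left δ⁻¹)
  rw [← div_eq_inv_mul, le_div_iff₀ hδ]
  exact mul_le_mul_of_nonneg_left (hφδ _ (hN _ (by omega))) (hg _)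

end StochasticApproximation

/-! ### From conditional probabilities of sets to conditional expectations of functions. -/

section ConditionalLaw

variable {Ω E : Type*} {m0 mΩ : MeasurableSpace Ω} {mE : MeasurableSpace E} {P : Measure Ω}
  [IsProbabilityMeasure P] {Y : Ω → E} {κ : Ω → Measure E}

/-- Turns the setwise almost sure identities, whose exceptional sets depend on B, into an equality
of measures on each event of the past. -/
theorem map_restrict_eq_bind (hm : m0 ≤ mΩ) (hY : Measurable Y) (hκ : Measurable[m0] κ)
    (hκp : ∀ ω, IsProbabilityMeasure (κ ω))
    (hlaw : ∀ B, MeasurableSet B → P⟦Y ⁻¹' B|m0⟧ =ᵐ[P] fun ω => (κ ω).real B) {s : Set Ω}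
    (hs : MeasurableSet[m0] s) : (P.restrict s).map Y = (P.restrict s).bind κ := by
  have hκ' : Measurable κ := hκ.mono hm le_rfl
  ext B hB
  rw [Measure.map_apply hY hB, Measure.bind_apply hB hκ'.aemeasurable,
    Measure.restrict_apply (hY hB)]
  have h1 := setIntegral_condExp hm (μ := P) (f := (Y ⁻¹' B).indicator fun _ => (1 : ℝ))
    ((integrable_const 1).indicator (hY hB)) hs
  rw [setIntegral_congr_ae (hm s hs) ((hlaw B hB).mono fun ω h _ => h),
    integral_indicator_const _ (hY hB), smul_eq_mul, mul_one, Measure.real,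
    Measure.restrict_apply (hY hB)] at h1
  simp only [Measure.real] at h1
  rw [integral_toReal (f := fun ω => κ ω B) ((Measure.measurable_coe hB).comp hκ').aemeasurable
    (ae_of_all _ fun ω => measure_lt_top _ _)] at h1
  refine ((ENNReal.toReal_eq_toReal_iff' ?_ ?_).1 h1).symm
  · refine (lt_of_le_of_lt (lintegral_mono fun ω => prob_le_one) ?_).ne
    simp
  · exact measure_ne_top _ _

theorem lintegral_comp_eq_lintegral_lintegral (hm : m0 ≤ mΩ) (hY : Measurable Y)
    (hκ : Measurable[m0] κ) (hκp : ∀ ω, IsProbabilityMeasure (κ ω))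
    (hlaw : ∀ B, MeasurableSet B → P⟦Y ⁻¹' B|m0⟧ =ᵐ[P] fun ω => (κ ω).real B) {f : E → ℝ≥0∞}
    (hf : Measurable f) : ∫⁻ ω, f (Y ω) ∂P = ∫⁻ ω, ∫⁻ z, f z ∂(κ ω) ∂P := by
  have h := map_restrict_eq_bind hm hY hκ hκp hlaw (MeasurableSet.univ (α := Ω))
  simp only [Measure.restrict_univ] at h
  rw [← lintegral_map hf hY, h, Measure.lintegral_bind (hκ.mono hm le_rfl).aemeasurable
    hf.aemeasurable]

theorem condExp_comp_eq_integral {F : Type*} [NormedAddCommGroup F] [NormedSpace ℝ F]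
    [CompleteSpace F] (hm : m0 ≤ mΩ) (hY : Measurable Y) (hκ : Measurable[m0] κ)
    (hκp : ∀ ω, IsProbabilityMeasure (κ ω))
    (hlaw : ∀ B, MeasurableSet B → P⟦Y ⁻¹' B|m0⟧ =ᵐ[P] fun ω => (κ ω).real B) {f : E → F}
    (hf : StronglyMeasurable f) (hfi : Integrable (fun ω => f (Y ω)) P) :
    P[fun ω => f (Y ω)|m0] =ᵐ[P] fun ω => ∫ z, f z ∂(κ ω) := by
  have hκ' : Measurable κ := hκ.mono hm le_rfl
  let k : Kernel Ω E := ⟨κ, hκ'⟩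
  have hkp : IsMarkovKernel k := ⟨hκp⟩
  have hbind : ∀ s, MeasurableSet[m0] s → (P.restrict s).map Y = k ∘ₘ (P.restrict s) :=
    fun s hs => map_restrict_eq_bind hm hY hκ hκp hlaw hs
  have hint : ∀ s, MeasurableSet[m0] s → Integrable f ((k ∘ₖ Kernel.const Unit (P.restrict s)) ()) :=
    fun s hs => by
      rw [← Measure.comp_eq_comp_const_apply, ← hbind s hs,
        integrable_map_measure hf.aestronglyMeasurable hY.aemeasurable]
      exact hfi.restrict
  symm
  refine ae_eq_condExp_of_forall_setIntegral_eq hm hfi (fun s hs _ => ?_) (fun s hs _ => ?_) ?_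
  · have := (hint s hs).integral_comp
    simp only [Kernel.const_apply] at this
    exact this
  · have h1 := Kernel.integral_comp (hint s hs)
    rw [← Measure.comp_eq_comp_const_apply, ← hbind s hs,
      integral_map hY.aemeasurable hf.aestronglyMeasurable] at h1
    rw [h1]
    simp only [Kernel.const_apply]
    rfl
  -- The same kernel, now over the smaller σ-algebra, so that the integral is measurable with
  -- respect to the past.
  · let k0 : @Kernel Ω E m0 mE := @Kernel.mk Ω E m0 mE κ hκ
    have : StronglyMeasurable[m0] fun ω => ∫ z, f z ∂(k0 ω) :=
      StronglyMeasurable.integral_kernel (κ := k0) hf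
    exact this.aestronglyMeasurable

end ConditionalLaw

/-! ### Geometry of the selection event. -/

section Selection

theorem inner_single_one {ι : Type*} [Fintype ι] [DecidableEq ι] (i : ι)
    (z : EuclideanSpace ℝ ι) : ⟪EuclideanSpace.single i (1 : ℝ), z⟫ = z i := by
  rw [EuclideanSpace.inner_single_left]
  simp

variable {p : ℕ} {l u : Fin p → EReal} {M : Finset (Fin p)}

theorem mem_selected {y : EuclideanSpace ℝ (Fin p)} {j : Fin p} :
    j ∈ selected l u y ↔ (y j : EReal) ≤ l j ∨ u j ≤ (y j : EReal) := by
  simp [selected]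

theorem mem_selectionEvent {z : EuclideanSpace ℝ (Fin p)} :
    z ∈ selectionEvent l u M ↔ ∀ j, ((z j : EReal) ≤ l j ∨ u j ≤ (z j : EReal)) ↔ j ∈ M := by
  simp only [selectionEvent, Set.mem_ofPred_eq, Finset.ext_iff, mem_selected]

theorem measurable_coord_coe (j : Fin p) :
    Measurable fun z : EuclideanSpace ℝ (Fin p) => ((z j : ℝ) : EReal) :=
  measurable_coe_real_ereal.comp (by fun_prop)

theorem continuous_coord_coe (j : Fin p) :
    Continuous fun z : EuclideanSpace ℝ (Fin p) => ((z j : ℝ) : EReal) :=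
  continuous_coe_real_ereal.comp (by fun_prop)

theorem measurableSet_selected_coord (j : Fin p) :
    MeasurableSet {z : EuclideanSpace ℝ (Fin p) | (z j : EReal) ≤ l j ∨ u j ≤ (z j : EReal)} :=
  (measurableSet_le (measurable_coord_coe j) measurable_const).union
    (measurableSet_le measurable_const (measurable_coord_coe j))

theorem measurableSet_selectionEvent : MeasurableSet (selectionEvent l u M) := by
  have h : selectionEvent l u M =
      ⋂ j, {z | ((z j : EReal) ≤ l j ∨ u j ≤ (z j : EReal)) ↔ j ∈ M} := by
    ext z; simp [mem_selectionEvent]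
  rw [h]
  exact MeasurableSet.iInter fun j => (measurableSet_selected_coord j).iff (.const _)

/-- The event is in general not open, but pushing each selected coordinate outwards (down if it is
at most l, up otherwise) and fixing the rest enters its interior. Hence the event has positive
Gaussian mass near each of its points. -/
theorem mem_closure_interior_selectionEvent {z : EuclideanSpace ℝ (Fin p)}
    (hz : z ∈ selectionEvent l u M) : z ∈ closure (interior (selectionEvent l u M)) := by
  rw [mem_selectionEvent] at hz
  classical
  set d : EuclideanSpace ℝ (Fin p) := WithLp.toLp 2 fun j =>
    if (z j : EReal) ≤ l j then -1 else if u j ≤ (z j : EReal) then 1 else 0 with hd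
  set I : Set (EuclideanSpace ℝ (Fin p)) := ⋂ j, if j ∈ M then
    {w | (w j : EReal) < l j ∨ u j < (w j : EReal)} else
    {w | l j < (w j : EReal) ∧ (w j : EReal) < u j} with hI
  have hIo : IsOpen I := by
    refine isOpen_iInter_of_finite fun j => ?_
    split_ifs
    · exact (isOpen_lt (continuous_coord_coe j) continuous_const).union
        (isOpen_lt continuous_const (continuous_coord_coe j))
    · exact (isOpen_lt continuous_const (continuous_coord_coe j)).inter
        (isOpen_lt (continuous_coord_coe j) continuous_const)
  have hIs : I ⊆ selectionEvent l u M := fun w hw => by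
    rw [mem_selectionEvent]
    intro j
    have := Set.mem_iInter.1 hw j
    split_ifs at this with hj
    · simp only [hj, iff_true]
      exact this.imp le_of_lt le_of_lt
    · simp only [hj, iff_false, not_or, not_le]
      exact this
  have hmem : ∀ ε : ℝ, 0 < ε → z + ε • d ∈ I := fun ε hε => by
    refine Set.mem_iInter.2 fun j => ?_
    have hj := hz j
    have hval : (z + ε • d) j = z j + ε * d j := rfl
    by_cases hl : (z j : EReal) ≤ l j
    · rw [if_pos (hj.1 (Or.inl hl))]
      left
      rw [hval]
      refine lt_of_lt_of_le (EReal.coe_lt_coe_iff.2 ?_) hl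
      simp [hd, hl, hε]
    · by_cases hu : u j ≤ (z j : EReal)
      · rw [if_pos (hj.1 (Or.inr hu))]
        right
        rw [hval]
        refine lt_of_le_of_lt hu (EReal.coe_lt_coe_iff.2 ?_)
        simp [hd, hl, hu, hε]
      · rw [if_neg (fun h => (hj.2 h).elim hl hu)]
        have : (z + ε • d) j = z j := by rw [hval]; simp [hd, hl, hu]
        simp only [Set.mem_ofPred_eq, this]
        exact ⟨not_le.1 hl, not_le.1 hu⟩
  have hlim : Tendsto (fun ε : ℝ => z + ε • d) (𝓝[>] 0) (𝓝 z) := by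
    have : Tendsto (fun ε : ℝ => z + ε • d) (𝓝 0) (𝓝 (z + (0 : ℝ) • d)) :=
      Continuous.tendsto (by fun_prop) 0
    simp only [zero_smul, add_zero] at this
    exact this.mono_left nhdsWithin_le_nhds
  exact mem_closure_of_tendsto hlim
    (eventually_nhdsWithin_of_forall fun ε hε => interior_maximal hIs hIo (hmem ε hε))

theorem measure_selectionEvent_inter_pos {S : Matrix (Fin p) (Fin p) ℝ} (hS : S.PosDef)
    (μ : EuclideanSpace ℝ (Fin p)) {z : EuclideanSpace ℝ (Fin p)}
    (hz : z ∈ selectionEvent l u M) {U : Set (EuclideanSpace ℝ (Fin p))} (hU : IsOpen U)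
    (hzU : z ∈ U) : 0 < multivariateGaussian μ S (selectionEvent l u M ∩ U) := by
  have := isOpenPosMeasure_multivariateGaussian hS μ
  obtain ⟨w, hwU, hwI⟩ := mem_closure_iff.1 (mem_closure_interior_selectionEvent hz) U hU hzU
  exact ((isOpen_interior.inter hU).measure_pos _ ⟨w, hwI, hwU⟩).trans_le
    (measure_mono (Set.inter_subset_inter_left _ interior_subset))

theorem measure_selectionEvent_pos {S : Matrix (Fin p) (Fin p) ℝ} (hS : S.PosDef)
    (μ : EuclideanSpace ℝ (Fin p)) {z : EuclideanSpace ℝ (Fin p)}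
    (hz : z ∈ selectionEvent l u M) : 0 < multivariateGaussian μ S (selectionEvent l u M) := by
  simpa using measure_selectionEvent_inter_pos hS μ hz isOpen_univ (Set.mem_univ z)

theorem ae_offThreshold {S : Matrix (Fin p) (Fin p) ℝ} (hS : S.PosDef)
    (μ : EuclideanSpace ℝ (Fin p)) : ∀ᵐ y ∂(multivariateGaussian μ S), OffThreshold l u y := by
  have h : ∀ (j : Fin p) (t : EReal), ∀ᵐ y ∂(multivariateGaussian μ S), ((y j : ℝ) : EReal) ≠ t := by
    intro j t
    -- For infinite t the event y_j = t is empty, so the default value of `toReal` does not matter.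
    have hj := multivariateGaussian_inner_eq_null hS μ (EuclideanSpace.single j 1)
      (by simp) t.toReal
    refine measure_mono_null (fun y hy => ?_) hj
    have hy' : ((y j : ℝ) : EReal) = t := not_not.1 hy
    show ⟪EuclideanSpace.single j (1 : ℝ), y⟫ = t.toReal
    rw [inner_single_one, ← hy', EReal.toReal_coe]
  filter_upwards [ae_all_iff.2 fun j => h j (u j), ae_all_iff.2 fun j => h j (l j)] with y h1 h2
  exact fun j _ => ⟨fun _ => h1 j, fun _ => h2 j⟩

/-- A value at most a can jump over a finite b; if b = ⊤, it can only move up within the lower ray,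
which needs t ≠ a. -/
theorem exists_selected_gt {a b : EReal} (hab : a < b) {t : ℝ} (ht : (t : EReal) ≤ a ∨ b ≤ t)
    (hne : b = ⊤ → (t : EReal) ≠ a) : ∃ s : ℝ, t < s ∧ ((s : EReal) ≤ a ∨ b ≤ s) := by
  rcases ht with h | h
  · induction b with
    | bot => exact absurd hab not_lt_bot
    | coe b =>
      exact ⟨max t b + 1, by linarith [le_max_left t b], Or.inr
        (EReal.coe_le_coe_iff.2 (by linarith [le_max_right t b]))⟩
    | top =>
      obtain ⟨s, h1, h2⟩ := EReal.lt_iff_exists_real_btwn.1 (lt_of_le_of_ne h (hne rfl))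
      exact ⟨s, EReal.coe_lt_coe_iff.1 h1, Or.inl h2.le⟩
  · exact ⟨t + 1, by linarith, Or.inr (h.trans (EReal.coe_le_coe_iff.2 (by linarith)))⟩

theorem exists_selected_lt {a b : EReal} (hab : a < b) {t : ℝ} (ht : (t : EReal) ≤ a ∨ b ≤ t)
    (hne : a = ⊥ → (t : EReal) ≠ b) : ∃ s : ℝ, s < t ∧ ((s : EReal) ≤ a ∨ b ≤ s) := by
  obtain ⟨s, h1, h2⟩ := exists_selected_gt (a := -b) (b := -a) (t := -t)
    (EReal.neg_lt_neg_iff.2 hab)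
    (by rw [EReal.coe_neg, EReal.neg_le_neg_iff, EReal.neg_le_neg_iff]; exact ht.symm)
    (fun h => by
      rw [EReal.coe_neg, Ne, neg_inj]
      exact hne (by simpa using h))
  refine ⟨-s, by linarith, ?_⟩
  rw [EReal.coe_neg, EReal.neg_le, EReal.le_neg]
  exact h2.symm

/-- Moving the single coordinate j in the direction of the sign of v_j suffices; `OffThreshold`
guarantees that both directions are available. -/
theorem exists_selectionEvent_inner_pos (hlu : ∀ j, l j < u j) {y : EuclideanSpace ℝ (Fin p)}
    (hy : OffThreshold l u y) {v : EuclideanSpace ℝ (Fin p)} {j : Fin p}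
    (hj : j ∈ selected l u y) (hv : v j ≠ 0) :
    ∃ z ∈ selectionEvent l u (selected l u y), 0 < ⟪v, z - y⟫ := by
  have hj' := mem_selected.1 hj
  obtain ⟨s, hs, hsel⟩ : ∃ s : ℝ, 0 < v j * (s - y j) ∧ ((s : EReal) ≤ l j ∨ u j ≤ s) := by
    rcases hv.lt_or_gt with h | h
    · obtain ⟨s, h1, h2⟩ := exists_selected_lt (hlu j) hj' (hy j hj).1
      exact ⟨s, mul_pos_of_neg_of_neg h (by linarith), h2⟩
    · obtain ⟨s, h1, h2⟩ := exists_selected_gt (hlu j) hj' (hy j hj).2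
      exact ⟨s, mul_pos h (by linarith), h2⟩
  refine ⟨y + EuclideanSpace.single j (s - y j), ?_, ?_⟩
  · rw [mem_selectionEvent]
    intro i
    rcases eq_or_ne i j with rfl | hij
    · simpa [hj] using hsel
    · simp [hij, mem_selected]
  · rw [add_sub_cancel_left, EuclideanSpace.inner_single_right]
    simpa [mul_comm] using hs

end Selection

/-! ### Lower bound on the selection probability and the variance bound. -/

section VarianceBound

/-- If m ≤ b, the lower tail alone suffices, since lowering the mean from b to m increases it. If m
≥ b, the upper tail has mass at least 1/2, and symmetry compares it with the left side. -/
theorem normalCDF_le_gaussianReal {a b : EReal} (hab : a < b) (m v : ℝ) :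
    normalCDF a b v ≤ gaussianReal m v.toNNReal {t | (t : EReal) ≤ a ∨ b ≤ (t : EReal)} := by
  induction a with
  | bot => simp [normalCDF_bot]
  | top => exact absurd hab not_top_lt
  | coe a =>
  induction b with
  | bot => exact absurd hab not_lt_bot
  | top => simp [normalCDF_top]
  | coe b =>
  have hab' : a < b := EReal.coe_lt_coe_iff.1 hab
  have hshift : ∀ c : ℝ, gaussianReal c v.toNNReal =
      (gaussianReal 0 v.toNNReal).map (fun t => t + c) := fun c => by
    rw [gaussianReal_map_add_const, zero_add]
  rw [normalCDF_coe, hshift b, hshift m, Measure.map_apply (by fun_prop) measurableSet_Iic]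
  have hset : {t : ℝ | (t : EReal) ≤ a ∨ (b : EReal) ≤ (t : EReal)} = Set.Iic a ∪ Set.Ici b := by
    ext t; simp
  rw [hset, Measure.map_apply (by fun_prop) (measurableSet_Iic.union measurableSet_Ici)]
  rcases le_total m b with h | h
  · refine measure_mono fun t ht => Or.inl ?_
    simp only [Set.mem_preimage, Set.mem_Iic] at ht ⊢
    linarith
  · have hneg : gaussianReal 0 v.toNNReal = (gaussianReal 0 v.toNNReal).map (fun t => -t) := by
      rw [gaussianReal_map_neg, neg_zero]
    conv_lhs => rw [hneg]
    rw [Measure.map_apply (by fun_prop) ((by fun_prop : Measurable fun t : ℝ => t + b)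
      measurableSet_Iic)]
    refine measure_mono fun t ht => Or.inr ?_
    simp only [Set.mem_preimage, Set.mem_Iic, Set.mem_Ici] at ht ⊢
    linarith

variable {p : ℕ} {S : Matrix (Fin p) (Fin p) ℝ}

/-- The coefficients of the residual of the `k`th coordinate after regression on the others. -/
noncomputable def residualVec (S : Matrix (Fin p) (Fin p) ℝ) (k : Fin p) :
    EuclideanSpace ℝ (Fin p) :=
  WithLp.toLp 2 fun i => if h : i ≠ k then
    -((S.submatrix (fun k : {i : Fin p // i ≠ k} => (k : Fin p))
        (fun k : {i : Fin p // i ≠ k} => (k : Fin p)))⁻¹ *ᵥ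
      (fun i : {i : Fin p // i ≠ k} => S i k)) ⟨i, h⟩ else 1

/-- The normal equations of the regression: the residual is uncorrelated with every other
coordinate. -/
theorem mulVec_residualVec (hS : S.PosDef) (k i : Fin p) :
    (S *ᵥ (residualVec S k).ofLp) i = if i = k then partialVar S k else 0 := by
  set T := S.submatrix (fun k : {i : Fin p // i ≠ k} => (k : Fin p))
        (fun k : {i : Fin p // i ≠ k} => (k : Fin p)) with hT
  set β := T⁻¹ *ᵥ (fun i : {i : Fin p // i ≠ k} => S i k) with hβ
  have hTu : IsUnit T.det := by
    have : T.PosDef := hS.submatrix Subtype.val_injective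
    exact this.det_pos.ne'.isUnit
  have hTβ : T *ᵥ β = fun i : {i : Fin p // i ≠ k} => S i k := by
    rw [hβ, mulVec_mulVec, mul_nonsing_inv _ hTu, one_mulVec]
  have hsum : (S *ᵥ (residualVec S k).ofLp) i = S i k - ∑ j : {i : Fin p // i ≠ k}, S i j * β j := by
    rw [mulVec, dotProduct, Fintype.sum_eq_add_sum_subtype_ne _ k]
    have h1 : (residualVec S k).ofLp k = 1 := by simp [residualVec]
    have h2 : ∀ j : {i : Fin p // i ≠ k}, (residualVec S k).ofLp j = -β j := fun j => by
      simp [residualVec, j.2, hβ, hT]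
    simp [h1, h2, sub_eq_add_neg]
  rw [hsum]
  split_ifs with h
  · subst h
    rfl
  · have := congrFun hTβ ⟨i, h⟩
    simp only [mulVec, dotProduct, hT, submatrix_apply] at this
    linarith

theorem residualVec_self (k : Fin p) : residualVec S k k = 1 := by simp [residualVec]

theorem covarianceBilin_residualVec (hS : S.PosDef) (μ v : EuclideanSpace ℝ (Fin p)) (k : Fin p) :
    covarianceBilin (multivariateGaussian μ S) v (residualVec S k) = v k * partialVar S k := by
  rw [covarianceBilin_multivariateGaussian hS.posSemidef]
  simp only [dotProduct, mulVec_residualVec hS, mul_ite, mul_zero, Finset.sum_ite_eq',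
    Finset.mem_univ, if_true]

theorem indepFun_residual (hS : S.PosDef) (μ : EuclideanSpace ℝ (Fin p)) (k : Fin p) :
    IndepFun (fun (z : EuclideanSpace ℝ (Fin p)) (i : {i : Fin p // i ≠ k}) => z i)
      (fun z (_ : Unit) => ⟪residualVec S k, z⟫) (multivariateGaussian μ S) := by
  refine HasGaussianLaw.indepFun_of_covariance_eval
    (X := fun (i : {i : Fin p // i ≠ k}) (z : EuclideanSpace ℝ (Fin p)) => z i)
    (Y := fun (_ : Unit) z => ⟪residualVec S k, z⟫) ?_ fun i _ => ?_
  · have h := (IsGaussian.hasGaussianLaw_id (μ := multivariateGaussian μ S)).map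
      (((ContinuousLinearMap.pi fun i : {i : Fin p // i ≠ k} =>
        (EuclideanSpace.proj (i : Fin p) : EuclideanSpace ℝ (Fin p) →L[ℝ] ℝ))).prod
      (ContinuousLinearMap.pi fun _ : Unit => innerSL ℝ (residualVec S k)))
    exact h
  · have h1 : (fun z : EuclideanSpace ℝ (Fin p) => z i) =
        fun z => ⟪EuclideanSpace.single (i : Fin p) (1 : ℝ), z⟫ := by
      ext z; rw [inner_single_one]
    simp only [h1]
    rw [← covarianceBilin_apply_eq_cov IsGaussian.memLp_two_id, covarianceBilin_residualVec hS]
    simp [i.2.symm]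

theorem map_residual (hS : S.PosDef) (μ : EuclideanSpace ℝ (Fin p)) (k : Fin p) :
    ∃ m, (multivariateGaussian μ S).map (fun z => ⟪residualVec S k, z⟫) =
      gaussianReal m (partialVar S k).toNNReal := by
  have hm : (multivariateGaussian μ S).map (innerSL ℝ (residualVec S k)) = _ :=
    IsGaussian.map_eq_gaussianReal (innerSL ℝ (residualVec S k))
  have hv : Var[innerSL ℝ (residualVec S k); multivariateGaussian μ S] = partialVar S k := by
    have h1 := covarianceBilin_residualVec hS μ (residualVec S k) k
    rw [covarianceBilin_self IsGaussian.memLp_two_id, residualVec_self, one_mul] at h1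
    exact h1
  rw [hv] at hm
  exact ⟨_, hm⟩

/-- Given the other coordinates, z_k is the independent residual minus a constant, hence normal with
variance `partialVar S k`. The tail bound is uniform in the mean, so it integrates over B, which
does not involve coordinate k. -/
theorem normalCDF_mul_measure_le (hS : S.PosDef) (μ : EuclideanSpace ℝ (Fin p)) (k : Fin p)
    {a b : EReal} (hab : a < b) {B : Set (EuclideanSpace ℝ (Fin p))} (hB : MeasurableSet B)
    (hdep : ∀ z z' : EuclideanSpace ℝ (Fin p), (∀ i ≠ k, z i = z' i) → z ∈ B → z' ∈ B) :
    normalCDF a b (partialVar S k) * multivariateGaussian μ S B ≤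
      multivariateGaussian μ S ({z | (z k : EReal) ≤ a ∨ b ≤ (z k : EReal)} ∩ B) := by
  set P := multivariateGaussian μ S with hP
  set X : EuclideanSpace ℝ (Fin p) → {i : Fin p // i ≠ k} → ℝ := fun z i => z i with hX
  set R : EuclideanSpace ℝ (Fin p) → Unit → ℝ := fun z _ => ⟪residualVec S k, z⟫ with hR
  have hXm : Measurable X := by fun_prop
  have hRm : Measurable R := by fun_prop
  -- Coordinate k is filled with 0; by `hdep` this does not affect membership in B.
  set ext : ({i : Fin p // i ≠ k} → ℝ) → EuclideanSpace ℝ (Fin p) := fun x =>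
    WithLp.toLp 2 fun i => if h : i ≠ k then x ⟨i, h⟩ else 0 with hext
  have hextm : Measurable ext := by
    refine (WithLp.measurable_toLp 2 _).comp (measurable_pi_lambda _ fun i => ?_)
    by_cases h : i ≠ k
    · simp only [dif_pos h]; fun_prop
    · simp only [dif_neg h]; fun_prop
  have hXB : X ⁻¹' (ext ⁻¹' B) = B := by
    have hagree : ∀ z, ∀ i ≠ k, (ext (X z)) i = z i := fun z i hi => by simp [hext, hX, hi]
    ext z
    exact ⟨hdep _ _ (hagree z), hdep _ _ fun i hi => (hagree z i hi).symm⟩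
  set C : Set ℝ := {t | (t : EReal) ≤ a ∨ b ≤ (t : EReal)} with hC
  have hCm : MeasurableSet C := (measurableSet_le measurable_coe_real_ereal measurable_const).union
    (measurableSet_le measurable_const measurable_coe_real_ereal)
  set c : ({i : Fin p // i ≠ k} → ℝ) → ℝ := fun x => ⟪residualVec S k, ext x⟫ with hc
  have hcm : Measurable c := by fun_prop
  have hzk : ∀ z, z k = R z () - c (X z) := fun z => by
    simp only [hR, hc]
    rw [← inner_sub_right, PiLp.inner_apply, Fintype.sum_eq_add_sum_subtype_ne _ k,
      Finset.sum_eq_zero fun i _ => ?_]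
    · simp [hext, residualVec_self]
    · simp [hext, hX, i.2]
  set W : Set (({i : Fin p // i ≠ k} → ℝ) × (Unit → ℝ)) :=
    {q | q.2 () - c q.1 ∈ C} ∩ (Prod.fst ⁻¹' (ext ⁻¹' B)) with hW
  have hWm : MeasurableSet W :=
    ((by fun_prop : Measurable fun q : ({i : Fin p // i ≠ k} → ℝ) × (Unit → ℝ) =>
      q.2 () - c q.1) hCm).inter (measurable_fst (hextm hB))
  have hset : {z : EuclideanSpace ℝ (Fin p) | (z k : EReal) ≤ a ∨ b ≤ (z k : EReal)} ∩ B =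
      (fun z => (X z, R z)) ⁻¹' W := by
    conv_lhs => rw [← hXB]
    ext z
    simp only [hW, Set.mem_inter_iff, Set.mem_preimage, Set.mem_ofPred_eq, ← hzk, hC]
  have hind := (indepFun_iff_map_prod_eq_prod_map_map hXm.aemeasurable hRm.aemeasurable).1
    (indepFun_residual hS μ k)
  obtain ⟨m, hm⟩ := map_residual hS μ k
  have : IsProbabilityMeasure (P.map R) := Measure.isProbabilityMeasure_map hRm.aemeasurable
  rw [hset, ← Measure.map_apply (hXm.prodMk hRm) hWm, hind, Measure.prod_apply hWm]
  have hle : ∀ x ∈ ext ⁻¹' B, normalCDF a b (partialVar S k) ≤ P.map R (Prod.mk x ⁻¹' W) := by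
    intro x hx
    have h1 : Prod.mk x ⁻¹' W = (fun r : Unit → ℝ => r () - c x) ⁻¹' C := by
      ext r
      simp only [hW, Set.mem_inter_iff, Set.mem_preimage, Set.mem_ofPred_eq]
      exact and_iff_left hx
    have h2 : P.map R ((fun r : Unit → ℝ => r () - c x) ⁻¹' C) =
        gaussianReal (m - c x) (partialVar S k).toNNReal C := by
      rw [← gaussianReal_map_sub_const, ← hm, Measure.map_apply (by fun_prop) hCm,
        Measure.map_apply (by fun_prop) ((by fun_prop : Measurable fun t : ℝ => t - c x) hCm),
        Measure.map_apply hRm ((by fun_prop : Measurable fun r : Unit → ℝ => r () - c x) hCm)]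
      rfl
    rw [h1, h2]
    exact normalCDF_le_gaussianReal hab _ _
  calc normalCDF a b (partialVar S k) * P B
      = ∫⁻ _ in ext ⁻¹' B, normalCDF a b (partialVar S k) ∂(P.map X) := by
        rw [setLIntegral_const, Measure.map_apply hXm (hextm hB), hXB]
    _ ≤ ∫⁻ x in ext ⁻¹' B, P.map R (Prod.mk x ⁻¹' W) ∂(P.map X) :=
        setLIntegral_mono' (hextm hB) hle
    _ ≤ _ := setLIntegral_le_lintegral _ _

theorem measure_mul_prod_normalCDF_le (hS : S.PosDef) {l u : Fin p → EReal}
    (hlu : ∀ j, l j < u j) (M : Finset (Fin p)) (μ : EuclideanSpace ℝ (Fin p)) :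
    multivariateGaussian μ S {z | ∀ k ∉ M, l k < (z k : EReal) ∧ (z k : EReal) < u k} *
        ∏ k ∈ M, normalCDF (l k) (u k) (partialVar S k) ≤
      multivariateGaussian μ S (selectionEvent l u M) := by
  classical
  set G : Finset (Fin p) → Set (EuclideanSpace ℝ (Fin p)) := fun F =>
    {z | ∀ k ∉ M, l k < (z k : EReal) ∧ (z k : EReal) < u k} ∩
      {z | ∀ k ∈ F, (z k : EReal) ≤ l k ∨ u k ≤ (z k : EReal)} with hG
  have hGm : ∀ F, MeasurableSet (G F) := fun F => by
    refine MeasurableSet.inter ?_ ?_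
    · simp only [Set.ofPred_forall]
      exact MeasurableSet.iInter fun k => MeasurableSet.iInter fun _ =>
        (measurableSet_lt measurable_const (measurable_coord_coe k)).inter
          (measurableSet_lt (measurable_coord_coe k) measurable_const)
    · simp only [Set.ofPred_forall]
      exact MeasurableSet.iInter fun k => MeasurableSet.iInter fun _ =>
        measurableSet_selected_coord k
  have hGM : G M = selectionEvent l u M := by
    ext z
    rw [mem_selectionEvent]
    constructor
    · rintro ⟨h1, h2⟩ j
      refine ⟨fun h => ?_, h2 j⟩
      by_contra hj
      exact h.elim (not_le.2 (h1 j hj).1) (not_le.2 (h1 j hj).2)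
    · intro h
      refine ⟨fun j hj => ?_, fun j hj => (h j).2 hj⟩
      have := mt (h j).1 hj
      rwa [not_or, not_le, not_le] at this
  -- Selected coordinates are imposed one at a time; the event for F leaves any k ∈ M outside F
  -- unconstrained.
  have key : ∀ F ⊆ M, multivariateGaussian μ S (G ∅) *
      ∏ k ∈ F, normalCDF (l k) (u k) (partialVar S k) ≤ multivariateGaussian μ S (G F) := by
    intro F
    induction F using Finset.induction_on with
    | empty => simp
    | insert k F hkF ih =>
      intro hF
      have hkM : k ∈ M := hF (Finset.mem_insert_self k F)
      rw [Finset.prod_insert hkF]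
      have hdep : ∀ z z' : EuclideanSpace ℝ (Fin p), (∀ i ≠ k, z i = z' i) → z ∈ G F →
          z' ∈ G F := by
        rintro z z' hzz ⟨h1, h2⟩
        refine ⟨fun i hi => ?_, fun i hi => ?_⟩
        · rw [← hzz i (fun h => hi (h ▸ hkM))]; exact h1 i hi
        · rw [← hzz i (fun h => hkF (h ▸ hi))]; exact h2 i hi
      calc _ = normalCDF (l k) (u k) (partialVar S k) * (multivariateGaussian μ S (G ∅) *
            ∏ k ∈ F, normalCDF (l k) (u k) (partialVar S k)) := by ring
        _ ≤ normalCDF (l k) (u k) (partialVar S k) * multivariateGaussian μ S (G F) := by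
            gcongr
            exact ih ((Finset.subset_insert k F).trans hF)
        _ ≤ _ := normalCDF_mul_measure_le hS μ k (hlu k) (hGm F) hdep
        _ = multivariateGaussian μ S (G (insert k F)) := by
            congr 1
            ext z
            simp only [hG, Set.mem_inter_iff, Set.mem_ofPred_eq, Finset.forall_mem_insert]
            tauto
  have := key M subset_rfl
  rw [hGM] at this
  simpa [hG] using this

theorem memLp_coord_multivariateGaussian (μ : EuclideanSpace ℝ (Fin p)) (j : Fin p) :
    MemLp (fun z : EuclideanSpace ℝ (Fin p) => z j) 2 (multivariateGaussian μ S) := by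
  have h := (IsGaussian.hasGaussianLaw_id (μ := multivariateGaussian μ S)).map
    (EuclideanSpace.proj j : EuclideanSpace ℝ (Fin p) →L[ℝ] ℝ)
  exact h.memLp_two

theorem lintegral_sub_mean_sq_le (hS : S.PosDef) {l u : Fin p → EReal} (hlu : ∀ j, l j < u j)
    {M : Finset (Fin p)} (hM : ∃ y, selected l u y = M) (μ : EuclideanSpace ℝ (Fin p))
    (j : Fin p) :
    MemLp (fun z : EuclideanSpace ℝ (Fin p) => z j) 2 (truncNormal S l u M μ) ∧
      ∫⁻ z, ENNReal.ofReal ((z j - condMean S l u M μ j) ^ 2) ∂(truncNormal S l u M μ) ≤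
        ENNReal.ofReal S.trace / (multivariateGaussian μ S
          {z | ∀ k ∉ M, l k < (z k : EReal) ∧ (z k : EReal) < u k} *
            ∏ k ∈ M, normalCDF (l k) (u k) (partialVar S k)) := by
  obtain ⟨y, hy⟩ := hM
  set A := selectionEvent l u M
  set P := multivariateGaussian μ S with hP
  have hA : 0 < P A := measure_selectionEvent_pos hS μ (z := y) hy
  have hprob : IsProbabilityMeasure (truncNormal S l u M μ) := cond_isProbabilityMeasure hA.ne'
  have hmem : MemLp (fun z : EuclideanSpace ℝ (Fin p) => z j) 2 (truncNormal S l u M μ) :=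
    ((memLp_coord_multivariateGaussian μ j).restrict A).smul_measure
      (ENNReal.inv_ne_top.2 hA.ne')
  refine ⟨hmem, ?_⟩
  have hsub : ∀ c : ℝ, MemLp (fun z : EuclideanSpace ℝ (Fin p) => z j - c) 2
      (truncNormal S l u M μ) := fun c => hmem.sub (memLp_const c)
  have hvar : ∫ z, (z j - condMean S l u M μ j) ^ 2 ∂(truncNormal S l u M μ) ≤
      ∫ z, (z j - μ j) ^ 2 ∂(truncNormal S l u M μ) := by
    have h1 := variance_eq_integral (μ := truncNormal S l u M μ)
      (X := fun z : EuclideanSpace ℝ (Fin p) => z j) (by fun_prop)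
    have h2 := variance_le_expectation_sq (μ := truncNormal S l u M μ)
      (X := fun z : EuclideanSpace ℝ (Fin p) => z j - μ j) (by fun_prop)
    rw [variance_sub_const (by fun_prop), h1] at h2
    exact h2
  have hSj : S j j ≤ S.trace :=
    Finset.single_le_sum (f := fun i => S i i) (fun i _ => hS.diag_pos.le) (Finset.mem_univ j)
  calc ∫⁻ z, ENNReal.ofReal ((z j - condMean S l u M μ j) ^ 2) ∂(truncNormal S l u M μ)
      = ENNReal.ofReal (∫ z, (z j - condMean S l u M μ j) ^ 2 ∂(truncNormal S l u M μ)) :=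
        (ofReal_integral_eq_lintegral_ofReal (hsub _).integrable_sq
          (ae_of_all _ fun z => sq_nonneg _)).symm
    _ ≤ ENNReal.ofReal (∫ z, (z j - μ j) ^ 2 ∂(truncNormal S l u M μ)) :=
        ENNReal.ofReal_le_ofReal hvar
    _ = ∫⁻ z, ENNReal.ofReal ((z j - μ j) ^ 2) ∂(truncNormal S l u M μ) :=
        ofReal_integral_eq_lintegral_ofReal (hsub _).integrable_sq
          (ae_of_all _ fun z => sq_nonneg _)
    _ = (P A)⁻¹ * ∫⁻ z in A, ENNReal.ofReal ((z j - μ j) ^ 2) ∂P := by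
        rw [truncNormal, ProbabilityTheory.cond, lintegral_smul_measure, smul_eq_mul]
    _ ≤ (P A)⁻¹ * ∫⁻ z, ENNReal.ofReal ((z j - μ j) ^ 2) ∂P :=
        mul_le_mul' le_rfl (setLIntegral_le_lintegral _ _)
    _ = (P A)⁻¹ * ENNReal.ofReal (S j j) := by
        have hmu : ∫ z, z j ∂P = μ j := by
          have h := ContinuousLinearMap.integral_comp_comm
            (EuclideanSpace.proj j : EuclideanSpace ℝ (Fin p) →L[ℝ] ℝ)
            (IsGaussian.integrable_id (μ := P))
          simp only [id_eq, integral_id_multivariateGaussian, hP] at h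
          exact h
        have hi : Integrable (fun z : EuclideanSpace ℝ (Fin p) => (z j - μ j) ^ 2) P :=
          ((memLp_coord_multivariateGaussian μ j).sub (memLp_const (μ j))).integrable_sq
        rw [← ofReal_integral_eq_lintegral_ofReal hi (ae_of_all _ fun z => sq_nonneg _),
          ← variance_eval_multivariateGaussian (μ := μ) hS.posSemidef j,
          variance_eq_integral (by fun_prop), ← hP, hmu]
    _ ≤ _ := by
        rw [mul_comm, ← div_eq_mul_inv]
        exact ENNReal.div_le_div (ENNReal.ofReal_le_ofReal hSj)
          (measure_mul_prod_normalCDF_le hS hlu M μ)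

end VarianceBound

/-! ### Robbins–Monro iteration in a Euclidean space. -/

section RobbinsMonro

variable {E Ω : Type*} [NormedAddCommGroup E] [InnerProductSpace ℝ E] [FiniteDimensional ℝ E]
  [MeasurableSpace E] [BorelSpace E] {mΩ : MeasurableSpace Ω} {P : Measure Ω}
  [IsProbabilityMeasure P] {𝓕 : Filtration ℕ mΩ} {κ : E → Measure E} {G : E → E} {x₀ : E}
  {γ : ℕ → ℝ} {x Y : ℕ → Ω → E} {C : ℝ}

/-- Carries square integrability from an iterate to its next increment, by integrating the
conditional second moment. -/
theorem memLp_two_of_integral_norm_sq_le (hκ : Measurable κ)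
    (hκp : ∀ z, IsProbabilityMeasure (κ z)) (hG : Measurable G)
    (hGL : ∀ z, MemLp G 2 (κ z))
    (hC : ∀ z, ∫ t, ‖G t‖ ^ 2 ∂(κ z) ≤ C * (1 + ‖z - x₀‖ ^ 2)) {Ω : Type*}
    {m0 mΩ : MeasurableSpace Ω} {P : Measure Ω} [IsProbabilityMeasure P] (hm : m0 ≤ mΩ)
    {X Z : Ω → E} (hX : StronglyMeasurable[m0] X) (hXL : MemLp X 2 P)
    (hZ : Measurable Z)
    (hlaw : ∀ B, MeasurableSet B → P⟦Z ⁻¹' B|m0⟧ =ᵐ[P] fun ω => (κ (X ω)).real B) :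
    MemLp (fun ω => G (Z ω)) 2 P := by
  refine ⟨(hG.comp hZ).aestronglyMeasurable, ?_⟩
  rw [eLpNorm_lt_top_iff_lintegral_rpow_enorm_lt_top two_ne_zero ENNReal.ofNat_ne_top]
  simp only [ENNReal.toReal_ofNat, ENNReal.rpow_ofNat]
  rw [lintegral_comp_eq_lintegral_lintegral hm hZ (hκ.comp hX.measurable) (fun ω => hκp (X ω))
    hlaw (f := fun t => ‖G t‖ₑ ^ 2) (by fun_prop)]
  have hi : Integrable (fun ω => C * (1 + ‖X ω - x₀‖ ^ 2)) P :=
    ((integrable_const 1).add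
      ((memLp_two_iff_integrable_sq_norm (hXL.sub (memLp_const x₀)).1).1
        (hXL.sub (memLp_const x₀)))).const_mul C
  refine lt_of_le_of_lt (lintegral_mono fun ω => ?_) hi.lintegral_lt_top
  have h1 : ∀ t, ‖G t‖ₑ ^ 2 = ENNReal.ofReal (‖G t‖ ^ 2) := fun t => by
    rw [ENNReal.ofReal_pow (norm_nonneg _), ofReal_norm]
  simp_rw [h1]
  rw [Function.comp_apply, ← ofReal_integral_eq_lintegral_ofReal
    ((memLp_two_iff_integrable_sq_norm (hGL (X ω)).1).1 (hGL (X ω)))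
    (ae_of_all _ fun t => sq_nonneg _)]
  exact ENNReal.ofReal_le_ofReal (hC _)

/-- Robbins–Monro convergence for an iteration confined to a closed set. -/
theorem ae_tendsto_robbinsMonro (hκ : Measurable κ)
    (hκp : ∀ z, IsProbabilityMeasure (κ z)) (hG : Measurable G) (hGL : ∀ z, MemLp G 2 (κ z))
    (hC0 : 0 ≤ C) (hC : ∀ z, ∫ t, ‖G t‖ ^ 2 ∂(κ z) ≤ C * (1 + ‖z - x₀‖ ^ 2))
    (hcont : Continuous fun z => ∫ t, G t ∂(κ z)) {H : Set E} (hH : IsClosed H)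
    (hneg : ∀ z ∈ H, z ≠ x₀ → ⟪z - x₀, ∫ t, G t ∂(κ z)⟫ < 0)
    (hγ : ∀ n, 0 ≤ γ n) (hdiv : ¬ Summable γ) (hsq : Summable fun n => γ n ^ 2)
    (hx : StronglyAdapted 𝓕 x) (hxH : ∀ n ω, x n ω ∈ H) (hx0 : MemLp (x 0) 2 P)
    (hY : ∀ n, Measurable (Y n))
    (hlaw : ∀ n B, MeasurableSet B → P⟦Y n ⁻¹' B|𝓕 n⟧ =ᵐ[P] fun ω => (κ (x n ω)).real B)
    (hstep : ∀ n ω, x (n + 1) ω = x n ω + γ n • G (Y n ω)) :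
    ∀ᵐ ω ∂P, Tendsto (fun n => x n ω) atTop (𝓝 x₀) := by
  have hGY : ∀ n, MemLp (x n) 2 P → MemLp (fun ω => G (Y n ω)) 2 P := fun n hn =>
    memLp_two_of_integral_norm_sq_le hκ hκp hG hGL hC (𝓕.le n) (hx n) hn (hY n) (hlaw n)
  have hxL : ∀ n, MemLp (x n) 2 P := fun n => by
    induction n with
    | zero => exact hx0
    | succ n ih =>
      have : x (n + 1) = x n + γ n • fun ω => G (Y n ω) := funext (hstep n)
      rw [this]
      exact ih.add ((hGY n ih).const_smul _)
  have hd : ∀ n, MemLp (fun ω => x n ω - x₀) 2 P := fun n => (hxL n).sub (memLp_const x₀)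
  have hdm : ∀ n, StronglyMeasurable[𝓕 n] (fun ω => x n ω - x₀) := fun n =>
    (hx n).sub stronglyMeasurable_const
  set φ : E → ℝ := fun z => -⟪z - x₀, ∫ t, G t ∂(κ z)⟫ with hφ
  have hφc : Continuous φ := by
    have : Continuous fun z => ⟪z - x₀, ∫ t, G t ∂(κ z)⟫ := by fun_prop
    exact this.neg
  have hφ0 : ∀ z ∈ H, 0 ≤ φ z := fun z hz => by
    rcases eq_or_ne z x₀ with rfl | h
    · simp [hφ]
    · exact (neg_pos.2 (hneg z hz h)).le
  have hVi : ∀ n, Integrable (fun ω => ‖x n ω - x₀‖ ^ 2) P := fun n =>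
    (memLp_two_iff_integrable_sq_norm (hd n).1).1 (hd n)
  have hcross : ∀ n, Integrable (fun ω => ⟪x n ω - x₀, G (Y n ω)⟫) P := fun n =>
    ((hd n).norm.integrable_mul (hGY n (hxL n)).norm).mono'
      ((hd n).1.inner (hGY n (hxL n)).1) (ae_of_all _ fun ω => norm_inner_le_norm _ _)
  have hGi : ∀ n, Integrable (fun ω => ‖G (Y n ω)‖ ^ 2) P := fun n =>
    (memLp_two_iff_integrable_sq_norm (hGY n (hxL n)).1).1 (hGY n (hxL n))
  have hce : ∀ n, P[fun ω => ⟪x n ω - x₀, G (Y n ω)⟫|𝓕 n] =ᵐ[P] fun ω => -φ (x n ω) := fun n => by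
    have hGY1 : Integrable (fun ω => G (Y n ω)) P :=
      (hGY n (hxL n)).integrable (by norm_num)
    have h1 := condExp_bilin_of_stronglyMeasurable_left (innerSL ℝ) (hdm n) (hcross n) hGY1
    have h2 := condExp_comp_eq_integral (𝓕.le n) (hY n) (hκ.comp (hx n).measurable)
      (fun ω => hκp (x n ω)) (hlaw n) hG.stronglyMeasurable hGY1
    filter_upwards [h1, h2] with ω h1 h2
    refine h1.trans ?_
    rw [h2, innerSL_apply_apply, hφ, neg_neg]
    rfl
  have hce2 : ∀ n, P[fun ω => ‖G (Y n ω)‖ ^ 2|𝓕 n] =ᵐ[P]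
      fun ω => ∫ t, ‖G t‖ ^ 2 ∂(κ (x n ω)) := fun n =>
    condExp_comp_eq_integral (𝓕.le n) (hY n) (hκ.comp (hx n).measurable)
      (fun ω => hκp (x n ω)) (hlaw n) (f := fun t => ‖G t‖ ^ 2)
      (hG.norm.pow_const 2).stronglyMeasurable (hGi n)
  -- Expanding the square, the cross term has conditional mean -2γφ, and the growth bound turns the
  -- quadratic term into the summable error Cγ².
  have hrec : ∀ n, P[fun ω => ‖x (n + 1) ω - x₀‖ ^ 2|𝓕 n] ≤ᵐ[P] fun ω =>
      (1 + C * γ n ^ 2) * ‖x n ω - x₀‖ ^ 2 + C * γ n ^ 2 - 2 * γ n * φ (x n ω) := fun n => by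
    have e : (fun ω => ‖x (n + 1) ω - x₀‖ ^ 2) = (fun ω => ‖x n ω - x₀‖ ^ 2) +
        ((2 * γ n) • (fun ω => ⟪x n ω - x₀, G (Y n ω)⟫) +
          (γ n ^ 2) • fun ω => ‖G (Y n ω)‖ ^ 2) := by
      ext ω
      have : x (n + 1) ω - x₀ = (x n ω - x₀) + γ n • G (Y n ω) := by rw [hstep]; abel
      rw [this, norm_add_sq_real, inner_smul_right, norm_smul, mul_pow, Real.norm_eq_abs, sq_abs]
      simp only [Pi.add_apply, Pi.smul_apply, smul_eq_mul]
      ring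
    rw [e]
    filter_upwards [condExp_add (hVi n) (((hcross n).smul (2 * γ n)).add
        ((hGi n).smul (γ n ^ 2))) (𝓕 n),
      condExp_add ((hcross n).smul (2 * γ n)) ((hGi n).smul (γ n ^ 2)) (𝓕 n),
      condExp_smul (2 * γ n) (fun ω => ⟪x n ω - x₀, G (Y n ω)⟫) (𝓕 n) (μ := P),
      condExp_smul (γ n ^ 2) (fun ω => ‖G (Y n ω)‖ ^ 2) (𝓕 n) (μ := P), hce n, hce2 n]
      with ω h1 h2 h3 h4 h5 h6
    rw [h1, Pi.add_apply, h2, Pi.add_apply, h3, h4, Pi.smul_apply, Pi.smul_apply, h5, h6,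
      condExp_of_stronglyMeasurable (f := fun ω => ‖x n ω - x₀‖ ^ 2) (𝓕.le n)
        ((hdm n).norm.pow 2) (hVi n)]
    simp only [smul_eq_mul]
    have := mul_le_mul_of_nonneg_left (hC (x n ω)) (sq_nonneg (γ n))
    nlinarith
  have hmain := ae_tendsto_and_summable_of_almost_supermartingale (P := P) (𝓕 := 𝓕)
    (V := fun n ω => ‖x n ω - x₀‖ ^ 2) (D := fun n ω => φ (x n ω)) (a := fun n => C * γ n ^ 2)
    (g := fun n => 2 * γ n) (fun n => (hdm n).norm.pow 2) hVi (fun n ω => sq_nonneg _)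
    (fun n => hφc.comp_stronglyMeasurable (hx n))
    (fun n => by simpa using (integrable_condExp.congr (hce n)).neg)
    (fun n ω => hφ0 _ (hxH n ω)) (fun n => mul_nonneg hC0 (sq_nonneg _)) (hsq.mul_left C)
    (fun n => mul_nonneg two_pos.le (hγ n)) hrec
  filter_upwards [hmain] with ω ⟨⟨v, hv⟩, hs⟩
  refine tendsto_of_tendsto_norm_of_summable hH hφc
    (fun z hz hne => neg_pos.2 (hneg z hz hne)) hγ hdiv (fun n => hxH n ω) hv ?_
  refine (hs.mul_left (1 / 2)).congr fun n => ?_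
  ring

end RobbinsMonro

/-! ### The truncated normal family and the root of the estimating function. -/

section PlugIn

variable {p : ℕ} {S : Matrix (Fin p) (Fin p) ℝ} {l u : Fin p → EReal} {M : Finset (Fin p)}

/-- The inverse covariance matrix as an operator. -/
noncomputable def precision (S : Matrix (Fin p) (Fin p) ℝ) :
    EuclideanSpace ℝ (Fin p) →L[ℝ] EuclideanSpace ℝ (Fin p) :=
  toEuclideanCLM (𝕜 := ℝ) S⁻¹

theorem precision_apply (x : EuclideanSpace ℝ (Fin p)) (j : Fin p) :
    precision S x j = (S⁻¹ *ᵥ x.ofLp) j := rfl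

theorem toEuclideanCLM_precision (hS : S.PosDef) (x : EuclideanSpace ℝ (Fin p)) :
    toEuclideanCLM (𝕜 := ℝ) S (precision S x) = x := by
  rw [precision, ← ContinuousLinearMap.comp_apply, ← ContinuousLinearMap.mul_def, ← map_mul,
    mul_nonsing_inv _ hS.det_pos.ne'.isUnit, map_one]
  rfl

theorem inner_precision_comm (hS : S.PosDef) (x z : EuclideanSpace ℝ (Fin p)) :
    ⟪precision S x, z⟫ = ⟪x, precision S z⟫ := by
  have hsa : IsSelfAdjoint (precision S) := by
    have : IsSelfAdjoint S⁻¹ := hS.inv.isHermitian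
    exact this.map _
  conv_lhs => rw [← hsa.adjoint_eq]
  exact ContinuousLinearMap.adjoint_inner_left _ _ _

theorem inner_precision_self_pos (hS : S.PosDef) {x : EuclideanSpace ℝ (Fin p)} (hx : x ≠ 0) :
    0 < ⟪x, precision S x⟫ := by
  rw [precision, inner_toEuclideanCLM]
  have := hS.inv.dotProduct_mulVec_pos (x := x.ofLp) (by simpa using hx)
  simpa using this

/-- The vectors supported on `M`. -/
def supportedOn (M : Finset (Fin p)) : Submodule ℝ (EuclideanSpace ℝ (Fin p)) where
  carrier := {w | ∀ j ∉ M, w j = 0}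
  add_mem' ha hb j hj := by simp [ha j hj, hb j hj]
  zero_mem' j _ := rfl
  smul_mem' c w hw j hj := by simp [hw j hj]

theorem mem_supportedOn {w : EuclideanSpace ℝ (Fin p)} :
    w ∈ supportedOn M ↔ ∀ j ∉ M, w j = 0 := Iff.rfl

theorem forall_supportedOn_inner_eq_zero {x : EuclideanSpace ℝ (Fin p)} :
    (∀ w ∈ supportedOn M, ⟪w, x⟫ = 0) ↔ ∀ j ∈ M, x j = 0 := by
  constructor
  · intro h j hj
    have := h (EuclideanSpace.single j 1) fun i hi => by
      have : i ≠ j := fun h => hi (h ▸ hj)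
      simp [this]
    rwa [inner_single_one] at this
  · intro h w hw
    rw [PiLp.inner_apply]
    refine Finset.sum_eq_zero fun j _ => ?_
    by_cases hj : j ∈ M
    · simp [h j hj]
    · simp [hw j hj]

/-- The coordinate projection onto the vectors supported on `M`. -/
noncomputable def restrictTo (M : Finset (Fin p)) (x : EuclideanSpace ℝ (Fin p)) :
    EuclideanSpace ℝ (Fin p) :=
  WithLp.toLp 2 fun j => if j ∈ M then x j else 0

theorem restrictTo_apply (x : EuclideanSpace ℝ (Fin p)) (j : Fin p) :
    restrictTo M x j = if j ∈ M then x j else 0 := rfl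

/-- `restrictTo` as a continuous linear map. -/
noncomputable def restrictToCLM (M : Finset (Fin p)) :
    EuclideanSpace ℝ (Fin p) →L[ℝ] EuclideanSpace ℝ (Fin p) :=
  LinearMap.toContinuousLinearMap
    { toFun := restrictTo M
      map_add' := fun x z => by
        ext j; simp only [restrictTo_apply, PiLp.add_apply]; split_ifs <;> simp
      map_smul' := fun c x => by
        ext j; simp only [restrictTo_apply, PiLp.smul_apply]; split_ifs <;> simp }

theorem restrictToCLM_apply (x : EuclideanSpace ℝ (Fin p)) (j : Fin p) :
    restrictToCLM M x j = if j ∈ M then x j else 0 := rfl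

theorem inner_restrictToCLM {w : EuclideanSpace ℝ (Fin p)} (hw : w ∈ supportedOn M)
    (x : EuclideanSpace ℝ (Fin p)) : ⟪w, restrictToCLM M x⟫ = ⟪w, x⟫ := by
  rw [PiLp.inner_apply, PiLp.inner_apply]
  refine Finset.sum_congr rfl fun j _ => ?_
  rw [restrictToCLM_apply]
  split_ifs with hj
  · rfl
  · simp [hw j hj]

theorem truncNormal_eq_expTilt (hS : S.PosDef) (hM : (selectionEvent l u M).Nonempty)
    (μ : EuclideanSpace ℝ (Fin p)) :
    truncNormal S l u M μ = expTilt (truncNormal S l u M 0) (precision S μ) := by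
  obtain ⟨z, hz⟩ := hM
  have h := multivariateGaussian_tilted hS.posSemidef (precision S μ)
  rw [toEuclideanCLM_precision hS] at h
  rw [truncNormal, ← h, cond_tilted measurableSet_selectionEvent
    (measure_selectionEvent_pos hS 0 hz).ne' (integrable_exp_inner_of_isGaussian _ _)]
  rfl

theorem isProbabilityMeasure_truncNormal (hS : S.PosDef) (hM : (selectionEvent l u M).Nonempty)
    (μ : EuclideanSpace ℝ (Fin p)) : IsProbabilityMeasure (truncNormal S l u M μ) := by
  obtain ⟨z, hz⟩ := hM
  exact cond_isProbabilityMeasure (measure_selectionEvent_pos hS μ hz).ne'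

theorem hasGaussianTail_truncNormal (hS : S.PosDef) (hM : (selectionEvent l u M).Nonempty)
    (μ : EuclideanSpace ℝ (Fin p)) : HasGaussianTail (truncNormal S l u M μ) := by
  obtain ⟨z, hz⟩ := hM
  obtain ⟨c, hc, hi⟩ := IsGaussian.exists_integrable_exp_sq (multivariateGaussian μ S)
  exact ⟨c, hc, hi.restrict.smul_measure
    (ENNReal.inv_ne_top.2 (measure_selectionEvent_pos hS μ hz).ne')⟩

theorem condMean_eq (hS : S.PosDef) (hM : (selectionEvent l u M).Nonempty)
    (μ : EuclideanSpace ℝ (Fin p)) (j : Fin p) :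
    condMean S l u M μ j = (∫ z, z ∂(truncNormal S l u M μ)) j := by
  have := isProbabilityMeasure_truncNormal hS hM μ
  exact ContinuousLinearMap.integral_comp_comm
    (EuclideanSpace.proj j : EuclideanSpace ℝ (Fin p) →L[ℝ] ℝ)
    (hasGaussianTail_truncNormal hS hM μ).integrable_id

theorem truncNormal_inner_ne_const (hS : S.PosDef) (hM : (selectionEvent l u M).Nonempty)
    (μ : EuclideanSpace ℝ (Fin p)) {η : EuclideanSpace ℝ (Fin p)} (hη : η ≠ 0) (c : ℝ) :
    ¬ ∀ᵐ z ∂(truncNormal S l u M μ), ⟪η, z⟫ = c := by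
  have := isProbabilityMeasure_truncNormal hS hM μ
  intro h
  have h2 : ∀ᵐ z ∂(truncNormal S l u M μ), ⟪η, z⟫ ≠ c := by
    have h3 : ∀ᵐ z ∂(multivariateGaussian μ S), ⟪η, z⟫ ≠ c := by
      simpa [ae_iff] using multivariateGaussian_inner_eq_null hS μ η hη c
    exact cond_absolutelyContinuous.ae_le h3
  have h4 : ∀ᵐ z ∂(truncNormal S l u M μ), False := by
    filter_upwards [h, h2] with z h h2 using h2 h
  exact h4.exists.elim fun _ h => h

/-- Testing against vectors supported on M and moving the symmetric S⁻¹ across puts the root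
equation in the natural-parameter form of the exponential family. -/
theorem psi_eq_zero_iff (hS : S.PosDef) {y μ : EuclideanSpace ℝ (Fin p)} :
    psi S l u y μ = 0 ↔ μ - y ∈ supportedOn (selected l u y) ∧
      ∀ w ∈ supportedOn (selected l u y),
        ⟪precision S w, (∫ z, z ∂(truncNormal S l u (selected l u y) μ)) - y⟫ = 0 := by
  have hM : (selectionEvent l u (selected l u y)).Nonempty := ⟨y, rfl⟩
  simp_rw [inner_precision_comm hS]
  rw [forall_supportedOn_inner_eq_zero, mem_supportedOn]
  have h1 : ∀ j, (S⁻¹ *ᵥ fun k => y k - condMean S l u (selected l u y) μ k) j =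
      -(precision S ((∫ z, z ∂(truncNormal S l u (selected l u y) μ)) - y) j) := fun j => by
    rw [← PiLp.neg_apply, ← map_neg, neg_sub, precision_apply]
    congr 2
    ext k
    rw [condMean_eq hS hM]
    rfl
  have h2 : psi S l u y μ = 0 ↔ ∀ j, psi S l u y μ j = 0 := by
    constructor
    · intro h j; rw [h]; rfl
    · intro h; ext j; exact h j
  rw [h2]
  have h3 : ∀ j, psi S l u y μ j = if j ∈ selected l u y then
      (S⁻¹ *ᵥ fun k => y k - condMean S l u (selected l u y) μ k) j else y j - μ j := fun j => rfl
  simp_rw [h3, h1]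
  constructor
  · intro h
    refine ⟨fun j hj => ?_, fun j hj => ?_⟩
    · have := h j
      rw [if_neg hj] at this
      rw [PiLp.sub_apply]
      linarith
    · have := h j
      rw [if_pos hj] at this
      linarith
  · rintro ⟨h, h'⟩ j
    split_ifs with hj
    · rw [h' j hj, neg_zero]
    · have := h j hj
      rw [PiLp.sub_apply] at this
      linarith

/-- Strictness holds because hyperplanes are Gaussian null sets, so no nonzero linear form is
constant under the truncated law. This gives both uniqueness of the root and the sign of the drift.
-/
theorem inner_precision_mean_sub_pos (hS : S.PosDef) (hM : (selectionEvent l u M).Nonempty)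
    {μ μ' : EuclideanSpace ℝ (Fin p)} (h : μ ≠ μ') :
    0 < ⟪precision S (μ' - μ), (∫ z, z ∂(truncNormal S l u M μ')) -
      ∫ z, z ∂(truncNormal S l u M μ)⟫ := by
  have hp := isProbabilityMeasure_truncNormal (l := l) (u := u) (M := M) hS hM 0
  have hne : precision S (μ' - μ) ≠ 0 := fun h0 => by
    have := inner_precision_self_pos hS (sub_ne_zero.2 h.symm)
    rw [h0, inner_zero_right] at this
    exact lt_irrefl _ this
  rw [truncNormal_eq_expTilt hS hM μ, truncNormal_eq_expTilt hS hM μ', map_sub]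
  refine (hasGaussianTail_truncNormal hS hM 0).inner_mean_sub_mean_pos fun c => ?_
  rw [← map_sub]
  exact truncNormal_inner_ne_const hS hM 0 hne c

theorem exists_psi_root (hS : S.PosDef) (hlu : ∀ j, l j < u j) {y : EuclideanSpace ℝ (Fin p)}
    (hy : OffThreshold l u y) : ∃ μhat, ∀ μ, psi S l u y μ = 0 ↔ μ = μhat := by
  set M := selected l u y with hMdef
  have hM : (selectionEvent l u M).Nonempty := ⟨y, rfl⟩
  have hp := isProbabilityMeasure_truncNormal (l := l) (u := u) (M := M) hS hM 0
  obtain ⟨v, ⟨h, hh, rfl⟩, hroot⟩ := (hasGaussianTail_truncNormal hS hM 0).exists_inner_mean_eq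
    ((supportedOn M).map (precision S).toLinearMap) y (precision S y) (by
      rintro _ ⟨h, hh, rfl⟩ hne
      have h0 : h ≠ 0 := by rintro rfl; simp at hne
      -- If S⁻¹h vanished on M, where h is supported, then ⟪h, S⁻¹h⟫ = 0, against positive
      -- definiteness.
      obtain ⟨j, hj, hjv⟩ : ∃ j ∈ M, precision S h j ≠ 0 := by
        by_contra! hcon
        have := forall_supportedOn_inner_eq_zero.2 hcon h hh
        exact (inner_precision_self_pos hS h0).ne' this
      obtain ⟨z, hz, hpos⟩ := exists_selectionEvent_inner_pos hlu hy hj hjv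
      have hopen : IsOpen {z | 0 < ⟪precision S h, z - y⟫} :=
        isOpen_lt continuous_const (by fun_prop)
      have := measure_selectionEvent_inter_pos hS 0 hz hopen hpos
      have hc : 0 < truncNormal S l u M 0 {z | 0 < ⟪precision S h, z - y⟫} := by
        rw [truncNormal, cond_apply measurableSet_selectionEvent]
        exact ENNReal.mul_pos (by simp) this.ne'
      exact hc.ne')
  refine ⟨y + h, ?_⟩
  have hsol : psi S l u y (y + h) = 0 := by
    rw [psi_eq_zero_iff hS]
    refine ⟨by simpa using hh, fun w hw => ?_⟩
    rw [truncNormal_eq_expTilt hS hM, map_add]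
    exact hroot _ ⟨w, hw, rfl⟩
  intro μ
  refine ⟨fun hμ => ?_, fun h => h ▸ hsol⟩
  by_contra hne
  rw [psi_eq_zero_iff hS] at hμ hsol
  have hpos := inner_precision_mean_sub_pos (l := l) (u := u) (M := M) hS hM hne
  have hw : y + h - μ ∈ supportedOn M := by
    rw [← sub_sub_sub_cancel_right _ _ y]
    exact (supportedOn M).sub_mem hsol.1 hμ.1
  have h1 := hμ.2 _ hw
  have h2 := hsol.2 _ hw
  rw [inner_sub_right] at h1 h2 hpos
  linarith

theorem continuous_mean_truncNormal (hS : S.PosDef) (hM : (selectionEvent l u M).Nonempty) :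
    Continuous fun μ => ∫ z, z ∂(truncNormal S l u M μ) := by
  have hp := isProbabilityMeasure_truncNormal (l := l) (u := u) (M := M) hS hM 0
  rw [funext fun μ => congrArg (fun Q => ∫ z, z ∂Q)
    (truncNormal_eq_expTilt (l := l) (u := u) hS hM μ)]
  exact (hasGaussianTail_truncNormal hS hM 0).continuous_mean_expTilt.comp (precision S).continuous

theorem measurable_truncNormal (hS : S.PosDef) (hM : (selectionEvent l u M).Nonempty) :
    Measurable fun μ => truncNormal S l u M μ := by
  have hp := isProbabilityMeasure_truncNormal (l := l) (u := u) (M := M) hS hM 0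
  rw [funext (truncNormal_eq_expTilt hS hM)]
  exact (hasGaussianTail_truncNormal hS hM 0).measurable_expTilt.comp
    (precision S).continuous.measurable

theorem memLp_id_truncNormal (hS : S.PosDef) (hM : (selectionEvent l u M).Nonempty)
    (μ : EuclideanSpace ℝ (Fin p)) : MemLp (fun z => z) 2 (truncNormal S l u M μ) := by
  have hp := isProbabilityMeasure_truncNormal (l := l) (u := u) (M := M) hS hM μ
  exact (memLp_two_iff_integrable_sq_norm (by fun_prop)).2
    ((hasGaussianTail_truncNormal hS hM μ).integrable_norm_pow 2)

theorem exists_integral_norm_sq_truncNormal_le (hS : S.PosDef)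
    (hM : (selectionEvent l u M).Nonempty)
    (A : EuclideanSpace ℝ (Fin p) →L[ℝ] EuclideanSpace ℝ (Fin p))
    (y x₀ : EuclideanSpace ℝ (Fin p)) :
    ∃ C : ℝ, 0 ≤ C ∧ ∀ μ, ∫ z, ‖A (y - z)‖ ^ 2 ∂(truncNormal S l u M μ) ≤
      C * (1 + ‖μ - x₀‖ ^ 2) := by
  have hp := isProbabilityMeasure_truncNormal (l := l) (u := u) (M := M) hS hM
  obtain ⟨C, hC0, hC⟩ := (hasGaussianTail_truncNormal (l := l) (u := u) hS hM
    0).exists_integral_norm_sq_le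
  have hC' : ∀ μ, ∫ z, ‖z‖ ^ 2 ∂(truncNormal S l u M μ) ≤ C * (1 + ‖precision S μ‖ ^ 2) :=
    fun μ => by
      rw [truncNormal_eq_expTilt hS hM μ]
      exact hC _
  have hsq : ∀ a b : EuclideanSpace ℝ (Fin p), ‖a - b‖ ^ 2 ≤ 2 * ‖a‖ ^ 2 + 2 * ‖b‖ ^ 2 :=
    fun a b => by
      have h2 := pow_le_pow_left₀ (norm_nonneg _) (norm_sub_le a b) 2
      nlinarith [sq_nonneg (‖a‖ - ‖b‖)]
  set B := ‖precision S‖ with hB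
  refine ⟨‖A‖ ^ 2 * (2 * ‖y‖ ^ 2 + 2 * C * (1 + 2 * B ^ 2 * (1 + ‖x₀‖ ^ 2))), by positivity,
    fun μ => ?_⟩
  have hi : Integrable (fun z : EuclideanSpace ℝ (Fin p) => ‖z‖ ^ 2) (truncNormal S l u M μ) :=
    (hasGaussianTail_truncNormal hS hM μ).integrable_norm_pow 2
  have hT : ‖precision S μ‖ ^ 2 ≤ B ^ 2 * (2 * ‖μ - x₀‖ ^ 2 + 2 * ‖x₀‖ ^ 2) := by
    have h1 := pow_le_pow_left₀ (norm_nonneg _) ((precision S).le_opNorm μ) 2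
    have h2 := hsq (μ - x₀) (-x₀)
    rw [sub_neg_eq_add, sub_add_cancel, norm_neg] at h2
    rw [mul_pow] at h1
    exact h1.trans (mul_le_mul_of_nonneg_left h2 (sq_nonneg _))
  calc ∫ z, ‖A (y - z)‖ ^ 2 ∂(truncNormal S l u M μ)
      ≤ ∫ z, ‖A‖ ^ 2 * (2 * ‖y‖ ^ 2 + 2 * ‖z‖ ^ 2) ∂(truncNormal S l u M μ) := by
        refine integral_mono_of_nonneg (ae_of_all _ fun z => sq_nonneg _)
          (((integrable_const _).add (hi.const_mul 2)).const_mul _) (ae_of_all _ fun z => ?_)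
        have h1 := pow_le_pow_left₀ (norm_nonneg _) (A.le_opNorm (y - z)) 2
        rw [mul_pow] at h1
        exact h1.trans (mul_le_mul_of_nonneg_left (hsq y z) (sq_nonneg _))
    _ = ‖A‖ ^ 2 * (2 * ‖y‖ ^ 2 + 2 * ∫ z, ‖z‖ ^ 2 ∂(truncNormal S l u M μ)) := by
        rw [integral_const_mul, integral_add (integrable_const _) (hi.const_mul 2),
          integral_const_mul (μ := truncNormal S l u M μ) 2 fun z => ‖z‖ ^ 2]
        simp only [integral_const, probReal_univ, one_smul]
    _ ≤ ‖A‖ ^ 2 * (2 * ‖y‖ ^ 2 + 2 * (C * (1 + B ^ 2 * (2 * ‖μ - x₀‖ ^ 2 + 2 * ‖x₀‖ ^ 2)))) := by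
        have h3 := (hC' μ).trans (mul_le_mul_of_nonneg_left (add_le_add_right hT 1) hC0)
        gcongr
    _ ≤ ‖A‖ ^ 2 * ((2 * ‖y‖ ^ 2 + 2 * C * (1 + 2 * B ^ 2 * (1 + ‖x₀‖ ^ 2))) *
          (1 + ‖μ - x₀‖ ^ 2)) := by
        refine mul_le_mul_of_nonneg_left ?_ (sq_nonneg _)
        have : 0 ≤ 2 * ‖y‖ ^ 2 * ‖μ - x₀‖ ^ 2 + 2 * C * (‖μ - x₀‖ ^ 2 +
          2 * B ^ 2 * ‖x₀‖ ^ 2 * ‖μ - x₀‖ ^ 2 + 2 * B ^ 2) := by positivity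
        linarith
    _ = _ := by ring

/-! ### Convergence of the plug-in ascent. -/

/-- The filtration obtained by dropping the initial σ-algebra. -/
def shiftFiltration {Ω : Type*} {mΩ : MeasurableSpace Ω} (𝓕 : Filtration ℕ mΩ) :
    Filtration ℕ mΩ where
  seq n := 𝓕 (n + 1)
  mono' _ _ h := 𝓕.mono (Nat.succ_le_succ h)
  le' n := 𝓕.le (n + 1)

/-- The step direction of the plug-in ascent as an operator. -/
noncomputable def ascentOp (S : Matrix (Fin p) (Fin p) ℝ) (M : Finset (Fin p)) :
    EuclideanSpace ℝ (Fin p) →L[ℝ] EuclideanSpace ℝ (Fin p) :=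
  (restrictToCLM M).comp (precision S)

section Ascent

variable {y m₀ μhat : EuclideanSpace ℝ (Fin p)} {Ω : Type*} {mΩ : MeasurableSpace Ω}
  {P : Measure Ω} {𝓕 : Filtration ℕ mΩ} {γ : ℕ → ℝ} {m Y : ℕ → Ω → EuclideanSpace ℝ (Fin p)}

theorem IsPlugInAscent.step_eq (hm : IsPlugInAscent P 𝓕 S l u y m₀ γ m Y) (i : ℕ) (ω : Ω) :
    m (i + 1) ω = restrictToCLM (selected l u y) (m i ω - y) + y +
      γ (i + 1) • ascentOp S (selected l u y) (y - Y (i + 1) ω) := by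
  ext j
  simp only [PiLp.add_apply, PiLp.smul_apply, ascentOp, ContinuousLinearMap.comp_apply,
    restrictToCLM_apply, PiLp.sub_apply, smul_eq_mul]
  split_ifs with hj
  · rw [hm.step_selected i ω j hj, sub_add_cancel]
    rfl
  · rw [hm.step_unselected i ω j hj]
    ring

theorem IsPlugInAscent.sub_mem_supportedOn (hm : IsPlugInAscent P 𝓕 S l u y m₀ γ m Y) (i : ℕ)
    (ω : Ω) : m (i + 1) ω - y ∈ supportedOn (selected l u y) := fun j hj => by
  rw [PiLp.sub_apply, hm.step_unselected i ω j hj, sub_self]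

theorem IsPlugInAscent.step_eq_add (hm : IsPlugInAscent P 𝓕 S l u y m₀ γ m Y) (i : ℕ) (ω : Ω) :
    m (i + 1 + 1) ω = m (i + 1) ω +
      γ (i + 1 + 1) • ascentOp S (selected l u y) (y - Y (i + 1 + 1) ω) := by
  have h : restrictToCLM (selected l u y) (m (i + 1) ω - y) = m (i + 1) ω - y := by
    ext j
    rw [restrictToCLM_apply]
    split_ifs with hj
    · rfl
    · exact (hm.sub_mem_supportedOn i ω j hj).symm
  rw [hm.step_eq (i + 1) ω, h, sub_add_cancel]

theorem IsPlugInAscent.measurable_iterate (hm : IsPlugInAscent P 𝓕 S l u y m₀ γ m Y) (i : ℕ) :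
    Measurable[𝓕 i] (m i) := by
  induction i with
  | zero =>
    rw [funext hm.init]
    exact measurable_const
  | succ i ih =>
    rw [funext (hm.step_eq i)]
    have h1 : Measurable[𝓕 (i + 1)] (m i) := ih.mono (𝓕.mono (Nat.le_succ i)) le_rfl
    have h2 : Measurable[𝓕 (i + 1)] fun ω => ascentOp S (selected l u y) (y - Y (i + 1) ω) :=
      (ascentOp S _).continuous.measurable.comp ((hm.measurable_draw i).const_sub y)
    have h3 : Measurable[𝓕 (i + 1)] fun ω => restrictToCLM (selected l u y) (m i ω - y) :=
      (restrictToCLM _).continuous.measurable.comp (h1.sub_const y)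
    exact (h3.add_const y).add (h2.fun_const_smul _)

theorem ae_tendsto_plugInAscent [IsProbabilityMeasure P] (hS : S.PosDef)
    (hroot : psi S l u y μhat = 0) (hγ : IsStepSize γ)
    (hm : IsPlugInAscent P 𝓕 S l u y m₀ γ m Y) :
    ∀ᵐ ω ∂P, Tendsto (fun i => m i ω) atTop (𝓝 μhat) := by
  set M := selected l u y with hMdef
  have hM : (selectionEvent l u M).Nonempty := ⟨y, rfl⟩
  have hp := isProbabilityMeasure_truncNormal (l := l) (u := u) (M := M) hS hM
  set A := ascentOp S M with hA
  obtain ⟨C, hC0, hC⟩ := exists_integral_norm_sq_truncNormal_le (l := l) (u := u) hS hM A y μhat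
  rw [psi_eq_zero_iff hS] at hroot
  have hGm : Measurable fun z : EuclideanSpace ℝ (Fin p) => A (y - z) := by fun_prop
  have hGL : ∀ μ, MemLp (fun z => A (y - z)) 2 (truncNormal S l u M μ) := fun μ =>
    A.comp_memLp' ((memLp_const y).sub (memLp_id_truncNormal hS hM μ))
  have hGint : ∀ μ, ∫ z, A (y - z) ∂(truncNormal S l u M μ) =
      A (y - ∫ z, z ∂(truncNormal S l u M μ)) := fun μ => by
    have hi := (hasGaussianTail_truncNormal hS hM μ).integrable_id
    have hyi : Integrable (fun z => y - z) (truncNormal S l u M μ) := (integrable_const y).sub hi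
    rw [A.integral_comp_comm hyi, integral_sub (integrable_const y) hi]
    simp
  have hYm : ∀ i, Measurable (Y (i + 1)) := fun i =>
    (hm.measurable_draw i).mono (𝓕.le _) le_rfl
  have hcont : Continuous fun μ => ∫ z, A (y - z) ∂(truncNormal S l u M μ) := by
    simp_rw [hGint]
    have := continuous_mean_truncNormal (l := l) (u := u) hS hM
    fun_prop
  have hm0 : MemLp (m 0) 2 P := by
    rw [funext hm.init]
    exact memLp_const m₀
  -- The start m₀ need not agree with y off M, but every iterate from time 1 on does, so the
  -- Robbins–Monro argument is started at m 1.
  have hm1 : MemLp (m 1) 2 P := by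
    rw [funext (hm.step_eq 0)]
    have h1 : MemLp (fun ω => A (y - Y (0 + 1) ω)) 2 P :=
      memLp_two_of_integral_norm_sq_le (measurable_truncNormal hS hM) hp hGm hGL hC (𝓕.le 0)
        (hm.measurable_iterate 0).stronglyMeasurable hm0 (hYm 0) (hm.law_draw 0)
    exact (((restrictToCLM M).comp_memLp' (hm0.sub (memLp_const y))).add
      (memLp_const y)).add (h1.const_smul (γ (0 + 1)))
  have hH : IsClosed {z : EuclideanSpace ℝ (Fin p) | z - y ∈ supportedOn M} :=
    (supportedOn M).closed_of_finiteDimensional.preimage (continuous_id.sub continuous_const)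
  -- As z - μhat is supported on M, the projection in the step can be dropped, and subtracting the
  -- root equation leaves minus the monotonicity form.
  have hneg : ∀ z ∈ {z : EuclideanSpace ℝ (Fin p) | z - y ∈ supportedOn M}, z ≠ μhat →
      ⟪z - μhat, ∫ t, A (y - t) ∂(truncNormal S l u M z)⟫ < 0 := fun z hz hne => by
    have hw : z - μhat ∈ supportedOn M := by
      rw [← sub_sub_sub_cancel_right _ _ y]
      exact (supportedOn M).sub_mem hz hroot.1
    have h1 := hroot.2 _ hw
    have h2 := inner_precision_mean_sub_pos (l := l) (u := u) hS hM hne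
    rw [hGint, hA, ascentOp, ContinuousLinearMap.comp_apply, inner_restrictToCLM hw,
      ← inner_precision_comm hS]
    rw [← neg_sub z, map_neg, inner_neg_left, inner_sub_right] at h2
    rw [inner_sub_right] at h1 ⊢
    linarith
  have hdiv : ¬ Summable fun n => γ (n + 1 + 1) := fun h =>
    not_tendsto_atTop_of_tendsto_nhds
      (((summable_nat_add_iff (f := fun n => γ (n + 1)) 1).1 h).hasSum.tendsto_sum_nat)
      hγ.sum_diverges
  have key := ae_tendsto_robbinsMonro (P := P) (𝓕 := shiftFiltration 𝓕)
    (x := fun n => m (n + 1)) (Y := fun n => Y (n + 1 + 1)) (γ := fun n => γ (n + 1 + 1))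
    (measurable_truncNormal hS hM) hp hGm hGL hC0 hC hcont hH hneg
    (fun n => hγ.nonneg (n + 1)) hdiv
    ((summable_nat_add_iff (f := fun n => γ (n + 1) ^ 2) 1).2 hγ.summable_sq)
    (fun n => (hm.measurable_iterate (n + 1)).stronglyMeasurable)
    (fun n ω => hm.sub_mem_supportedOn n ω) hm1 (fun n => hYm (n + 1))
    (fun n => hm.law_draw (n + 1)) hm.step_eq_add
  filter_upwards [key] with ω h
  exact (tendsto_add_atTop_iff_nat 1).1 h

end Ascent

end PlugIn

end SelectedMeans

theorem mainTheorem5 {p : ℕ} (S : Matrix (Fin p) (Fin p) ℝ) (hS : S.PosDef)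
    (l u : Fin p → EReal) (hlu : ∀ j, l j < u j) :
    -- the conditional squared deviation bound, for every model that can be selected
    (∀ (M : Finset (Fin p)), (∃ y, SelectedMeans.selected l u y = M) →
      ∀ μ : EuclideanSpace ℝ (Fin p),
        0 < multivariateGaussian μ S (SelectedMeans.selectionEvent l u M) ∧
        ∀ j ∈ M,
          MemLp (fun z : EuclideanSpace ℝ (Fin p) => z j) 2
            (SelectedMeans.truncNormal S l u M μ) ∧
          ∫⁻ z, ENNReal.ofReal ((z j - SelectedMeans.condMean S l u M μ j) ^ 2)
              ∂(SelectedMeans.truncNormal S l u M μ)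
            ≤ ENNReal.ofReal S.trace /
                (multivariateGaussian μ S
                    {z | ∀ k ∉ M, l k < (z k : EReal) ∧ (z k : EReal) < u k} *
                  ∏ k ∈ M, SelectedMeans.normalCDF (l k) (u k) (SelectedMeans.partialVar S k))) ∧
    -- almost every observation satisfies the condition under which convergence is claimed
    (∀ μ : EuclideanSpace ℝ (Fin p),
      ∀ᵐ y ∂(multivariateGaussian μ S), SelectedMeans.OffThreshold l u y) ∧
    -- the plug-in algorithm converges almost surely to the unique root of `ψ`
    (∀ y : EuclideanSpace ℝ (Fin p), SelectedMeans.OffThreshold l u y →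
      ∃ μhat : EuclideanSpace ℝ (Fin p),
        (∀ μ, SelectedMeans.psi S l u y μ = 0 ↔ μ = μhat) ∧
        ∀ {Ω : Type*} {mΩ : MeasurableSpace Ω} (P : Measure Ω) [IsProbabilityMeasure P]
          (𝓕 : Filtration ℕ mΩ) (m₀ : EuclideanSpace ℝ (Fin p)) (γ : ℕ → ℝ)
          (m Y : ℕ → Ω → EuclideanSpace ℝ (Fin p)),
          SelectedMeans.IsStepSize γ →
          SelectedMeans.IsPlugInAscent P 𝓕 S l u y m₀ γ m Y →
          ∀ᵐ ω ∂P, Tendsto (fun i => m i ω) atTop (𝓝 μhat)) := by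
  refine ⟨fun M hM μ => ⟨?_, fun j _ => SelectedMeans.lintegral_sub_mean_sq_le hS hlu hM μ j⟩,
    fun μ => SelectedMeans.ae_offThreshold hS μ, fun y hy => ?_⟩
  · obtain ⟨y, hy⟩ := hM
    exact SelectedMeans.measure_selectionEvent_pos hS μ (z := y) hy
  · obtain ⟨μhat, h⟩ := SelectedMeans.exists_psi_root hS hlu hy
    refine ⟨μhat, h, ?_⟩
    intro Ω mΩ P _ 𝓕 m₀ γ m Y hγ hm
    exact SelectedMeans.ae_tendsto_plugInAscent hS ((h μhat).2 rfl) hγ hm
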